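/- **Conventions.** Let $P$ be a Markov transition probability on a measurable space $(E,\mathcal E)$ and let $\phi$ be a nontrivial measure on $\mathcal E$. - $\mathcal E^+$ is the class of nonnegative measurable functions $\eta$ with $\phi\{\eta>0\}>0$. - $\eta\in\mathcal E^+$ is *small* if $P^m\ge b\,\eta\otimes\lambda$ for some integer $m\ge 1$, some constant $b>0$ and some nonzero measure $\lambda$, where $(\eta\otimes\lambda)(x,A)=\eta(x)\lambda(A)$. - The chain is *$\phi$-irreducible* if for every $A$ with $\phi(A)>0$ and every $x\in E$ we have $P^n(x,A)>0$ for some $n$. It is ($\phi$-)*Harris recurrent* if every $A$ with $\phi(A)>0$ is visited infinitely often with probability one from every starting point $x\in E$. - An *atom* is a pair $(s,\nu)$ of a function $s\in\mathcal E^+$ and a probability measure $\nu$ with $P\ge s\otimes\nu$. It defines the measure $\pi_s=\nu\sum_{\ell\ge0}(P-s\otimes\nu)^\ell$. - For $\beta\in(0,1)$ the chain is *$\beta$-null recurrent* if there are a small function $f$, an initial distribution $\lambda$ and a slowly varying function $L$ with $$\mathbb E_\lambda\sum_{t=0}^n f(X_t)\sim\frac{1}{\Gamma(1+\beta)}\,n^\beta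 L(n)\qquad(n\to\infty).$$ **Lemma 4.1.** Let $\{(X_t,W_t)\}_{t\ge0}$ be a process with values in a product $(E_1\times E_2,\mathcal E_1\otimes\mathcal E_2)$ of two measurable spaces, with an arbitrary initial distribution. Assume: - $(\mathrm D_1)$ $\{(X_t,W_t)\}$ is a $\phi$-irreducible, Harris recurrent Markov chain with transition probability $P$, and $(s,\nu)$ is an atom for $P$. - $(\mathrm D_2)$ The marginal process $\{X_t\}$ is a $\phi_1$-irreducible, Harris recurrent Markov chain on $(E_1,\mathcal E_1)$ with transition probability $P_1$; $(s_1,\nu_1)$ is an atom for $P_1$; the chain $\{X_t\}$ is $\beta$-null recurrent; and $C_1\in\mathcal E_1$ is a set with $\phi_1(C_1)>0$, $\phi(C_1\times E_2)>0$ and $\pi_s 1_{C_1\times E_2}<\infty$. Let $\pi_s^X=\pi_s(\,\cdot\times E_2)$ be the $X$-marginal of $\pi_s$. Then the compound chain $\{(X_t,W_t)\}$ is $\beta$-null recurrent (with the same $\beta$), $0<\pi_s^X s_1<\infty$, and $$\pi_{s_1}1_{C_1}=\frac{\pi_s 1_{C_1\times E_2}}{\pi_s^X s_1}.$$ -/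

import Mathlib

open MeasureTheory ProbabilityTheory Filter
open scoped ENNReal Topology

/-- The law on path space `ℕ → E` of the Markov chain with transition probability `P` and initial
distribution `lam`. -/
noncomputable def chainLaw {E : Type*} [MeasurableSpace E] (P : Kernel E E) [IsMarkovKernel P]
    (lam : Measure E) : Measure (ℕ → E) :=
  Kernel.trajMeasure (X := fun _ => E) lam
    (fun n => P.comap (fun h : (i : Finset.Iic n) → E => h ⟨n, Finset.mem_Iic.2 le_rfl⟩)
      (measurable_pi_apply _))

/-- The process `Z` on the probability space `(Ω, μ)` is a (time homogeneous) Markov chain with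
transition probability `P`, with arbitrary initial distribution: given the history
`(Z 0, …, Z n)`, the variable `Z (n + 1)` has law `P (Z n, ·)`. -/
structure IsMarkovChain {E Ω : Type*} [MeasurableSpace E] [MeasurableSpace Ω]
    (P : Kernel E E) (Z : ℕ → Ω → E) (μ : Measure Ω) : Prop where
  measurable : ∀ t, Measurable (Z t)
  markov : ∀ n : ℕ,
    μ.map (fun ω => ((fun i : Finset.Iic n => Z i ω), Z (n + 1) ω)) =
      (μ.map (fun ω => fun i : Finset.Iic n => Z i ω)) ⊗ₘ
        P.comap (fun h : (i : Finset.Iic n) → E => h ⟨n, Finset.mem_Iic.2 le_rfl⟩)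
          (measurable_pi_apply _)

/-- The class `𝓔⁺` of nonnegative measurable functions with `φ`-positive support. -/
def IsPosFun {E : Type*} [MeasurableSpace E] (φ : Measure E) (η : E → ℝ≥0∞) : Prop :=
  Measurable η ∧ 0 < φ {x | 0 < η x}

/-- `η ∈ 𝓔⁺` is small: `P ^ m ≥ b η ⊗ lam` for some `m ≥ 1`, some `b > 0` and some nonzero
measure `lam`. Such an `η` is automatically finite and bounded. -/
def IsSmallFun {E : Type*} [MeasurableSpace E] (φ : Measure E) (P : Kernel E E)
    (η : E → ℝ≥0∞) : Prop :=
  IsPosFun φ η ∧ ∃ (lam : Measure E) (b : ℝ) (m : ℕ), lam ≠ 0 ∧ 0 < b ∧ 1 ≤ m ∧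
    ∀ x, (ENNReal.ofReal b * η x) • lam ≤ (P ^ m) x

/-- The chain with transition probability `P` is `φ`-irreducible, for a nontrivial measure `φ`,
and Harris recurrent: from every starting point, every `φ`-positive set is almost surely visited
infinitely often. -/
structure IsHarrisRecurrent {E : Type*} [MeasurableSpace E] (φ : Measure E) (P : Kernel E E)
    [IsMarkovKernel P] : Prop where
  nontrivial : φ ≠ 0
  irreducible : Kernel.IsIrreducible φ P
  recurrent : ∀ A : Set E, MeasurableSet A → 0 < φ A → ∀ x : E,
    ∀ᵐ ω ∂(chainLaw P (Measure.dirac x)), ∃ᶠ t in atTop, ω t ∈ A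

/-- An atom `(s, ν)` for `P`, that is, a function `s ∈ 𝓔⁺` and a probability measure `ν` with
`P ≥ s ⊗ ν`. The inequality makes `s` a small function and `ν` a small measure. -/
structure Atom {E : Type*} [MeasurableSpace E] (φ : Measure E) (P : Kernel E E) where
  s : E → ℝ≥0∞
  ν : Measure E
  isPosFun : IsPosFun φ s
  isProb : IsProbabilityMeasure ν
  minorization : ∀ x, s x • ν ≤ P x

namespace Atom

variable {E : Type*} [MeasurableSpace E] {φ : Measure E} {P : Kernel E E}

theorem isSmallFun (a : Atom φ P) : IsSmallFun φ P a.s :=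
  ⟨a.isPosFun, a.ν, 1, 1, a.isProb.ne_zero, one_pos, le_rfl, by
    intro x
    simpa using a.minorization x⟩

theorem s_le_one [IsMarkovKernel P] (a : Atom φ P) (x : E) : a.s x ≤ 1 := by
  have h := a.minorization x Set.univ
  have := a.isProb
  simpa using h

theorem sub_apply [IsMarkovKernel P] (a : Atom φ P) (x : E) {A : Set E} (hA : MeasurableSet A) :
    (P x - a.s x • a.ν) A = P x A - a.s x * a.ν A := by
  have := a.isProb
  have : IsFiniteMeasure (a.s x • a.ν) := isFiniteMeasure_of_le (P x) (a.minorization x)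
  rw [Measure.sub_apply hA (a.minorization x)]
  simp

/-- The kernel `P - s ⊗ ν`. -/
noncomputable def taboo [IsMarkovKernel P] (a : Atom φ P) : Kernel E E where
  toFun x := P x - a.s x • a.ν
  measurable' := by
    refine Measure.measurable_of_measurable_coe _ fun A hA => ?_
    simp_rw [a.sub_apply _ hA]
    exact (P.measurable_coe hA).sub (a.isPosFun.1.mul_const _)

/-- The kernel `G = ∑ ℓ ≥ 0, (P - s ⊗ ν) ^ ℓ`. -/
noncomputable def green [IsMarkovKernel P] (a : Atom φ P) : Kernel E E :=
  Kernel.sum (fun l : ℕ => a.taboo ^ l)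

/-- The invariant measure `π_s = ν G` attached to the atom `(s, ν)`. -/
noncomputable def invMeasure [IsMarkovKernel P] (a : Atom φ P) : Measure E :=
  a.ν.bind a.green

end Atom

/-- Slowly varying functions (at infinity). -/
structure IsSlowlyVarying (L : ℝ → ℝ) : Prop where
  measurable : Measurable L
  eventually_pos : ∀ᶠ x in atTop, 0 < L x
  tendsto : ∀ c : ℝ, 0 < c → Tendsto (fun x => L (c * x) / L x) atTop (𝓝 1)

/-- The chain with transition probability `P` is `β`-null recurrent: `β ∈ (0, 1)` and
`E_lam ∑_{t ≤ n} f (X_t) ~ n ^ β L n / Γ (1 + β)` as `n → ∞`, for some small function `f`, some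
initial distribution `lam` and some slowly varying function `L`. -/
def IsBetaNullRecurrent {E : Type*} [MeasurableSpace E] (φ : Measure E) (P : Kernel E E)
    [IsMarkovKernel P] (β : ℝ) : Prop :=
  0 < β ∧ β < 1 ∧ ∃ (f : E → ℝ≥0∞) (lam : Measure E) (L : ℝ → ℝ),
    IsSmallFun φ P f ∧ IsProbabilityMeasure lam ∧ IsSlowlyVarying L ∧
    Asymptotics.IsEquivalent atTop
      (fun n : ℕ => (∫⁻ ω, ∑ t ∈ Finset.range (n + 1), f (ω t) ∂(chainLaw P lam)).toReal)
      (fun n : ℕ => 1 / Real.Gamma (1 + β) * (n : ℝ) ^ β * L n)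

/-! ### Iterates of a kernel and expected occupation sums. -/

section Operators

variable {E : Type*} [MeasurableSpace E]

/-! For an atom write Q = P - s ⊗ ν, G = ∑ Q^l, π = νG, U_n f = ∑_{t<n} P^t f, and let A(n) = ν U_n
s be the renewal function. The same trajectory is measured by two clocks: S_n, the sum of s along
(X, W), and S'_n, the sum of s₁ along X, with renewal functions A and A'.

The engine is a ratio limit theorem in probability (`inProbZero_centred`): for measurable 0 ≤ f ≤ 1
with π f finite, ∑ f - π(f) S_n is negligible against A(n), under any initial law. On the compound
chain it gives S' ≈ q S with q = π_s^X s₁, and ∑ 1_C₁(X_t) ≈ π_s(C₁ × E₂) S; on the marginal chain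
it gives ∑ 1_C₁(X_t) ≈ π_s₁(C₁) S'. The means of S_n and S'_n are asymptotic to A and A' whatever
the initial law, and their second moments are of the order of the squared means, so relations in
probability pass to means (`eventually_mean_le`). Hence A' ~ q A and π_s₁(C₁) q = π_s(C₁ × E₂).
Since X is β-null recurrent, A' varies regularly with index β, and therefore so does A. Finiteness
of q and of π_s₁(C₁) is not given; it comes from one-sided versions of the same comparison for
truncated functions (`factor_comparison`).

The ratio limit theorem rests on the Poisson equation f + P G f = G f + π(f) s. When G f is bounded,
the centred sum has bounded conditional expectations, so its second moment is only O(A(n)). A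
general f is cut down to {U_k s ≥ 1}, where its potential is at most k²; under the initial law ν the
remainder is small in L¹. Other initial laws are reached in probability only: the relevant
expectation is almost subharmonic in the starting point, and the chain regenerates almost surely. -/

theorem lintegral_pow_succ (P : Kernel E E) (n : ℕ) (x : E) {f : E → ℝ≥0∞} (hf : Measurable f) :
    ∫⁻ y, f y ∂(P ^ (n + 1)) x = ∫⁻ y, ∫⁻ z, f z ∂(P ^ n) y ∂P x := by
  rw [Kernel.pow_add, Kernel.lintegral_comp _ _ _ hf, pow_one]

theorem lintegral_pow_succ' (P : Kernel E E) (n : ℕ) (x : E) {f : E → ℝ≥0∞} (hf : Measurable f) :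
    ∫⁻ y, f y ∂(P ^ (n + 1)) x = ∫⁻ y, ∫⁻ z, f z ∂P y ∂(P ^ n) x := by
  rw [add_comm, Kernel.pow_add, Kernel.lintegral_comp _ _ _ hf, pow_one]

theorem lintegral_pow_add (P : Kernel E E) (m n : ℕ) (x : E) {f : E → ℝ≥0∞} (hf : Measurable f) :
    ∫⁻ y, f y ∂(P ^ (m + n)) x = ∫⁻ y, ∫⁻ z, f z ∂(P ^ m) y ∂(P ^ n) x := by
  rw [Kernel.pow_add, Kernel.lintegral_comp _ _ _ hf]

theorem lintegral_pow_zero (P : Kernel E E) (x : E) {f : E → ℝ≥0∞} (hf : Measurable f) :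
    ∫⁻ y, f y ∂(P ^ 0) x = f x := by
  change ∫⁻ y, f y ∂Kernel.id x = f x
  rw [Kernel.id_apply, lintegral_dirac' _ hf]

instance isMarkovKernel_pow (P : Kernel E E) [IsMarkovKernel P] (n : ℕ) :
    IsMarkovKernel (P ^ n) := by
  induction n with
  | zero => exact inferInstanceAs (IsMarkovKernel Kernel.id)
  | succ n ih => rw [Kernel.pow_add, pow_one]; infer_instance

/-- The expected sum of the values of `f` along the first `n` states of the chain. -/
noncomputable def occupation (P : Kernel E E) (f : E → ℝ≥0∞) (n : ℕ) (x : E) : ℝ≥0∞ :=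
  ∑ t ∈ Finset.range n, ∫⁻ y, f y ∂(P ^ t) x

theorem measurable_occupation (P : Kernel E E) {f : E → ℝ≥0∞} (hf : Measurable f) (n : ℕ) :
    Measurable (occupation P f n) := by
  unfold occupation
  exact Finset.measurable_fun_sum _ fun t _ => hf.lintegral_kernel

theorem occupation_zero (P : Kernel E E) (f : E → ℝ≥0∞) (x : E) : occupation P f 0 x = 0 := by
  simp [occupation]

theorem occupation_succ (P : Kernel E E) (f : E → ℝ≥0∞) (n : ℕ) (x : E) :
    occupation P f (n + 1) x = occupation P f n x + ∫⁻ y, f y ∂(P ^ n) x :=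
  Finset.sum_range_succ _ _

theorem occupation_succ' (P : Kernel E E) {f : E → ℝ≥0∞} (hf : Measurable f) (n : ℕ) (x : E) :
    occupation P f (n + 1) x = f x + ∫⁻ y, occupation P f n y ∂P x := by
  unfold occupation
  rw [Finset.sum_range_succ', lintegral_pow_zero _ _ hf, add_comm, lintegral_finsetSum]
  · simp_rw [lintegral_pow_succ P _ x hf]
  · exact fun t _ => hf.lintegral_kernel

theorem occupation_mono (P : Kernel E E) (f : E → ℝ≥0∞) (x : E) :
    Monotone fun n => occupation P f n x := fun _ _ h =>
  Finset.sum_le_sum_of_subset (Finset.range_mono h)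

theorem occupation_le (P : Kernel E E) [IsMarkovKernel P] {f : E → ℝ≥0∞} (hf1 : ∀ x, f x ≤ 1)
    (n : ℕ) (x : E) : occupation P f n x ≤ n := by
  calc occupation P f n x ≤ ∑ t ∈ Finset.range n, (1 : ℝ≥0∞) := by
        refine Finset.sum_le_sum fun t _ => ?_
        calc ∫⁻ y, f y ∂(P ^ t) x ≤ ∫⁻ _, 1 ∂(P ^ t) x := lintegral_mono hf1
          _ = 1 := by simp
    _ = n := by simp

end Operators

/-! ### Regeneration: taboo kernel, Green kernel and Poisson equation. -/

namespace Atom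

variable {E : Type*} [MeasurableSpace E] {φ : Measure E} {P : Kernel E E} (a : Atom φ P)

theorem measurable_s : Measurable a.s := a.isPosFun.1

/-- The expected sum of `s` along the first `n` states of the chain started from `ν`. -/
noncomputable def renewal (n : ℕ) : ℝ≥0∞ := ∫⁻ x, occupation P a.s n x ∂a.ν

theorem renewal_mono : Monotone a.renewal := fun _ _ h =>
  lintegral_mono fun x => occupation_mono P a.s x h

variable [IsMarkovKernel P]

theorem lintegral_eq (x : E) (f : E → ℝ≥0∞) :
    ∫⁻ y, f y ∂P x = ∫⁻ y, f y ∂a.taboo x + a.s x * ∫⁻ y, f y ∂a.ν := by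
  have := a.isProb
  have : IsFiniteMeasure (a.s x • a.ν) := isFiniteMeasure_of_le (P x) (a.minorization x)
  have h : a.taboo x + a.s x • a.ν = P x := Measure.sub_add_cancel_of_le (a.minorization x)
  rw [← h, lintegral_add_measure, lintegral_smul_measure, smul_eq_mul]

theorem lintegral_taboo_pow_one_succ (n : ℕ) (x : E) :
    (a.taboo ^ n) x Set.univ =
      (a.taboo ^ (n + 1)) x Set.univ + ∫⁻ y, a.s y ∂(a.taboo ^ n) x := by
  have := a.isProb
  have h (y : E) : 1 = a.taboo y Set.univ + a.s y := by
    have := a.lintegral_eq y (fun _ => 1)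
    simpa using this
  have h2 := lintegral_pow_succ' a.taboo n x (f := fun _ => 1) measurable_const
  simp only [lintegral_const, one_mul] at h2
  rw [h2, ← lintegral_add_right _ a.measurable_s]
  simp_rw [← h]
  simp

/-- The chain either stays in its initial cycle or regenerates. -/
theorem sum_taboo_add (n : ℕ) (x : E) :
    occupation a.taboo a.s n x + (a.taboo ^ n) x Set.univ = 1 := by
  induction n with
  | zero =>
    have := lintegral_pow_zero a.taboo x (f := fun _ => 1) measurable_const
    rw [occupation_zero, zero_add]
    simpa only [lintegral_const, one_mul] using this
  | succ n ih =>
    rw [occupation_succ, add_assoc, add_comm (∫⁻ y, a.s y ∂(a.taboo ^ n) x),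
      ← a.lintegral_taboo_pow_one_succ, ih]

theorem occupation_taboo_le_one (n : ℕ) (x : E) : occupation a.taboo a.s n x ≤ 1 := by
  rw [← a.sum_taboo_add n x]; exact le_self_add

theorem taboo_pow_univ_le_one (n : ℕ) (x : E) : (a.taboo ^ n) x Set.univ ≤ 1 := by
  rw [← a.sum_taboo_add n x]; exact le_add_self

theorem taboo_pow_univ_antitone (x : E) : Antitone fun n => (a.taboo ^ n) x Set.univ :=
  antitone_nat_of_succ_le fun n => by
    rw [a.lintegral_taboo_pow_one_succ n x]; exact le_self_add

theorem renewal_le (n : ℕ) : a.renewal n ≤ n := by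
  have := a.isProb
  calc a.renewal n ≤ ∫⁻ _, (n : ℝ≥0∞) ∂a.ν :=
        lintegral_mono fun x => occupation_le P a.s_le_one n x
    _ = n := by simp

theorem renewal_ne_top (n : ℕ) : a.renewal n ≠ ∞ :=
  ne_top_of_le_ne_top (ENNReal.natCast_ne_top n) (a.renewal_le n)

/-- Decomposition at the first regeneration: before it only the taboo kernel acts, and after it the
chain restarts from ν and collects at most `a.renewal n`. Keeping n fixed in the factor lets the
induction on m close. -/
theorem occupation_le_mul (n m : ℕ) (h : m ≤ n) (x : E) :
    occupation P a.s m x ≤ (1 + a.renewal n) * occupation a.taboo a.s m x := by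
  induction m generalizing x with
  | zero => simp [occupation_zero]
  | succ m ih =>
    rw [occupation_succ' _ a.measurable_s, occupation_succ' _ a.measurable_s, a.lintegral_eq]
    have h1 : ∫⁻ y, occupation P a.s m y ∂a.taboo x ≤
        (1 + a.renewal n) * ∫⁻ y, occupation a.taboo a.s m y ∂a.taboo x := by
      rw [← lintegral_const_mul _ (measurable_occupation _ a.measurable_s _)]
      exact lintegral_mono fun y => ih (by omega) y
    have h2 : ∫⁻ y, occupation P a.s m y ∂a.ν ≤ a.renewal n := a.renewal_mono (by omega)
    calc a.s x + (∫⁻ y, occupation P a.s m y ∂a.taboo x +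
          a.s x * ∫⁻ y, occupation P a.s m y ∂a.ν)
        ≤ a.s x + ((1 + a.renewal n) * ∫⁻ y, occupation a.taboo a.s m y ∂a.taboo x +
          a.s x * a.renewal n) := by gcongr
      _ = _ := by ring

theorem occupation_le_renewal (n : ℕ) (x : E) :
    occupation P a.s n x ≤ 1 + a.renewal n := by
  calc _ ≤ (1 + a.renewal n) * occupation a.taboo a.s n x := a.occupation_le_mul n n le_rfl x
    _ ≤ (1 + a.renewal n) * 1 := by gcongr; exact a.occupation_taboo_le_one n x
    _ = _ := mul_one _

theorem lintegral_occupation_le (n : ℕ) (x : E) :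
    ∫⁻ y, occupation P a.s n y ∂P x ≤ occupation P a.s n x + 1 := by
  calc _ ≤ occupation P a.s (n + 1) x := by
        rw [occupation_succ' _ a.measurable_s]; exact le_add_self
    _ ≤ _ := by
      rw [occupation_succ]
      gcongr
      calc ∫⁻ y, a.s y ∂(P ^ n) x ≤ ∫⁻ _, 1 ∂(P ^ n) x := lintegral_mono a.s_le_one
        _ = 1 := by simp

/-- Lower counterpart of `occupation_le_mul`: a path that regenerates within k steps collects a full
`a.renewal n` afterwards. Delaying the window of n states by one step costs at most 1, whence the
error k. -/
theorem renewal_mul_le (n k : ℕ) (x : E) :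
    ∫⁻ y, occupation P a.s n y ∂(a.taboo ^ k) x +
      a.renewal n * occupation a.taboo a.s k x ≤ occupation P a.s n x + k := by
  induction k with
  | zero =>
    rw [lintegral_pow_zero _ _ (measurable_occupation P a.measurable_s n), occupation_zero]
    simp
  | succ k ih =>
    have hm := measurable_occupation P a.measurable_s n
    rw [lintegral_pow_succ' _ _ _ hm, occupation_succ, mul_add, ← add_assoc]
    have h1 : ∫⁻ y, ∫⁻ z, occupation P a.s n z ∂a.taboo y ∂(a.taboo ^ k) x +
        a.renewal n * ∫⁻ y, a.s y ∂(a.taboo ^ k) x ≤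
        ∫⁻ y, occupation P a.s n y ∂(a.taboo ^ k) x + 1 := by
      rw [← lintegral_const_mul _ a.measurable_s,
        ← lintegral_add_right _ (a.measurable_s.const_mul _)]
      calc _ ≤ ∫⁻ y, (occupation P a.s n y + 1) ∂(a.taboo ^ k) x := by
            refine lintegral_mono fun y => ?_
            refine le_trans (le_of_eq ?_) (a.lintegral_occupation_le n y)
            rw [a.lintegral_eq, mul_comm (a.s y)]; rfl
        _ = ∫⁻ y, occupation P a.s n y ∂(a.taboo ^ k) x + (a.taboo ^ k) x Set.univ := by
            rw [lintegral_add_right _ measurable_const]; simp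
        _ ≤ _ := by gcongr; exact a.taboo_pow_univ_le_one k x
    push_cast
    calc _ = (∫⁻ y, ∫⁻ z, occupation P a.s n z ∂a.taboo y ∂(a.taboo ^ k) x +
        a.renewal n * ∫⁻ y, a.s y ∂(a.taboo ^ k) x) +
          a.renewal n * occupation a.taboo a.s k x := by ring
      _ ≤ (∫⁻ y, occupation P a.s n y ∂(a.taboo ^ k) x + 1) +
          a.renewal n * occupation a.taboo a.s k x := by gcongr
      _ = (∫⁻ y, occupation P a.s n y ∂(a.taboo ^ k) x +
          a.renewal n * occupation a.taboo a.s k x) + 1 := by ring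
      _ ≤ occupation P a.s n x + k + 1 := by gcongr
      _ = _ := by ring

/-- Iteration of an approximate subharmonicity inequality. -/
theorem le_of_le_lintegral {p : E → ℝ≥0∞} (hp : Measurable p) (hp1 : ∀ x, p x ≤ 1) {δ : ℝ≥0∞}
    (h : ∀ x, p x ≤ ∫⁻ y, p y ∂P x + δ) (k : ℕ) (x : E) :
    p x ≤ k * δ + (a.taboo ^ k) x Set.univ + ∫⁻ y, p y ∂a.ν := by
  have key : ∀ k : ℕ, p x ≤ k * δ + ∫⁻ y, p y ∂(a.taboo ^ k) x +
      (∫⁻ y, p y ∂a.ν) * occupation a.taboo a.s k x := by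
    intro k
    induction k with
    | zero => rw [lintegral_pow_zero _ _ hp, occupation_zero]; simp
    | succ k ih =>
      have h1 : ∫⁻ y, p y ∂(a.taboo ^ k) x ≤ δ + ∫⁻ y, p y ∂(a.taboo ^ (k + 1)) x +
          (∫⁻ y, p y ∂a.ν) * ∫⁻ y, a.s y ∂(a.taboo ^ k) x := by
        rw [lintegral_pow_succ' _ _ _ hp, ← lintegral_const_mul _ a.measurable_s]
        calc ∫⁻ y, p y ∂(a.taboo ^ k) x
            ≤ ∫⁻ y, (δ + ∫⁻ z, p z ∂a.taboo y + (∫⁻ y, p y ∂a.ν) * a.s y) ∂(a.taboo ^ k) x := by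
              refine lintegral_mono fun y => (h y).trans (le_of_eq ?_)
              rw [a.lintegral_eq]; ring
          _ = δ * (a.taboo ^ k) x Set.univ + ∫⁻ y, ∫⁻ z, p z ∂a.taboo y ∂(a.taboo ^ k) x +
              ∫⁻ y, (∫⁻ y, p y ∂a.ν) * a.s y ∂(a.taboo ^ k) x := by
              rw [lintegral_add_right _ (a.measurable_s.const_mul _),
                lintegral_add_left measurable_const, lintegral_const]
          _ ≤ _ := by
              gcongr
              calc _ ≤ δ * 1 := by gcongr; exact a.taboo_pow_univ_le_one k x
                _ = δ := mul_one _
      rw [occupation_succ]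
      push_cast
      calc p x ≤ _ := ih
        _ ≤ k * δ + (δ + ∫⁻ y, p y ∂(a.taboo ^ (k + 1)) x +
          (∫⁻ y, p y ∂a.ν) * ∫⁻ y, a.s y ∂(a.taboo ^ k) x) +
          (∫⁻ y, p y ∂a.ν) * occupation a.taboo a.s k x := by gcongr
        _ = _ := by ring
  refine (key k).trans ?_
  gcongr
  · calc ∫⁻ y, p y ∂(a.taboo ^ k) x ≤ ∫⁻ _, 1 ∂(a.taboo ^ k) x := lintegral_mono hp1
      _ = _ := by simp
  · calc _ ≤ (∫⁻ y, p y ∂a.ν) * 1 := by gcongr; exact a.occupation_taboo_le_one k x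
      _ = _ := mul_one _

theorem lintegral_green (x : E) (f : E → ℝ≥0∞) :
    ∫⁻ y, f y ∂a.green x = ∑' l : ℕ, ∫⁻ y, f y ∂(a.taboo ^ l) x := by
  rw [green, Kernel.sum_apply, lintegral_sum_measure]

theorem lintegral_invMeasure {f : E → ℝ≥0∞} (hf : Measurable f) :
    ∫⁻ y, f y ∂a.invMeasure = ∫⁻ x, ∫⁻ y, f y ∂a.green x ∂a.ν := by
  rw [invMeasure, Measure.lintegral_bind (Kernel.aemeasurable _) hf.aemeasurable]

theorem green_eq {f : E → ℝ≥0∞} (hf : Measurable f) (x : E) :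
    ∫⁻ y, f y ∂a.green x = f x + ∫⁻ z, ∫⁻ y, f y ∂a.green z ∂a.taboo x := by
  simp_rw [lintegral_green]
  rw [tsum_eq_zero_add' ENNReal.summable, lintegral_pow_zero _ _ hf, lintegral_tsum]
  · simp_rw [lintegral_pow_succ _ _ _ hf]
  · exact fun l => hf.lintegral_kernel.aemeasurable

/-- G f = f + Q G f, and P exceeds Q by s ⊗ ν with ν G f = π(f). The additive form avoids
subtraction and remains valid when the potential is infinite. -/
theorem poisson {f : E → ℝ≥0∞} (hf : Measurable f) (x : E) :
    f x + ∫⁻ z, ∫⁻ y, f y ∂a.green z ∂P x =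
      ∫⁻ y, f y ∂a.green x + (∫⁻ y, f y ∂a.invMeasure) * a.s x := by
  rw [a.green_eq hf x, a.lintegral_eq, a.lintegral_invMeasure hf]; ring

/-- The iterated Poisson equation. -/
theorem occupation_add {f : E → ℝ≥0∞} (hf : Measurable f) (n : ℕ) (x : E) :
    occupation P f n x + ∫⁻ z, ∫⁻ y, f y ∂a.green z ∂(P ^ n) x =
      ∫⁻ y, f y ∂a.green x + (∫⁻ y, f y ∂a.invMeasure) * occupation P a.s n x := by
  have hg : Measurable fun z => ∫⁻ y, f y ∂a.green z := hf.lintegral_kernel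
  induction n with
  | zero => rw [lintegral_pow_zero _ _ hg, occupation_zero, occupation_zero]; simp
  | succ n ih =>
    have h1 : ∫⁻ y, f y ∂(P ^ n) x + ∫⁻ z, ∫⁻ y, f y ∂a.green z ∂(P ^ (n + 1)) x =
        ∫⁻ z, ∫⁻ y, f y ∂a.green z ∂(P ^ n) x +
          (∫⁻ y, f y ∂a.invMeasure) * ∫⁻ y, a.s y ∂(P ^ n) x := by
      rw [lintegral_pow_succ' _ _ _ hg, ← lintegral_const_mul _ a.measurable_s,
        ← lintegral_add_left hf, ← lintegral_add_left hg]
      simp_rw [a.poisson hf]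
    rw [occupation_succ, occupation_succ, add_assoc, h1, ← add_assoc, ih]; ring

/-- Integrated against ν, the potential G f becomes π(f). Starting from ν therefore replaces
boundedness of G f by mere integrability of f. -/
theorem lintegral_nu_occupation_le {f : E → ℝ≥0∞} (hf : Measurable f) (n : ℕ) :
    ∫⁻ x, occupation P f n x ∂a.ν ≤ (∫⁻ y, f y ∂a.invMeasure) * (1 + a.renewal n) := by
  calc ∫⁻ x, occupation P f n x ∂a.ν
      ≤ ∫⁻ x, (∫⁻ y, f y ∂a.green x + (∫⁻ y, f y ∂a.invMeasure) * occupation P a.s n x) ∂a.ν :=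
        lintegral_mono fun x => by rw [← a.occupation_add hf]; exact le_self_add
    _ = _ := by
      have hm := measurable_occupation P a.measurable_s n
      rw [lintegral_add_right _ (hm.const_mul _), lintegral_const_mul _ hm,
        ← a.lintegral_invMeasure hf, renewal]; ring

/-- If s is read as the probability of regenerating at the next transition, the left side is the
probability of a regeneration at a given time and the right side that of a first regeneration no
later. -/
theorem pow_s_le (n : ℕ) (x : E) :
    ∫⁻ y, a.s y ∂(P ^ n) x ≤ occupation a.taboo a.s (n + 1) x := by
  induction n generalizing x with
  | zero =>
    rw [lintegral_pow_zero _ _ a.measurable_s, occupation_succ, occupation_zero, zero_add,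
      lintegral_pow_zero _ _ a.measurable_s]
  | succ n ih =>
    have := a.isProb
    rw [lintegral_pow_succ _ _ _ a.measurable_s, a.lintegral_eq,
      occupation_succ' _ a.measurable_s, add_comm]
    gcongr
    · calc _ ≤ a.s x * ∫⁻ _, 1 ∂a.ν := by
            gcongr with y
            exact (ih y).trans (a.occupation_taboo_le_one _ _)
        _ = a.s x := by simp
    · exact ih _

/-- The terms Q^(i+l) s form a tail of the distribution of the first regeneration time, whose total
mass is at most one. -/
theorem green_pow_taboo_le (i : ℕ) (x : E) :
    ∫⁻ z, ∫⁻ y, a.s y ∂(a.taboo ^ i) z ∂a.green x ≤ 1 := by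
  rw [lintegral_green]
  refine ENNReal.tsum_le_of_sum_range_le fun n => ?_
  simp_rw [← lintegral_pow_add _ _ _ _ a.measurable_s]
  refine le_trans ?_ (a.occupation_taboo_le_one (i + n) x)
  unfold occupation
  rw [Finset.sum_range_add]
  exact le_add_self

theorem green_pow_le (n : ℕ) (x : E) :
    ∫⁻ z, ∫⁻ y, a.s y ∂(P ^ n) z ∂a.green x ≤ n + 1 := by
  calc _ ≤ ∫⁻ z, occupation a.taboo a.s (n + 1) z ∂a.green x :=
        lintegral_mono fun z => a.pow_s_le n z
    _ = ∑ i ∈ Finset.range (n + 1), ∫⁻ z, ∫⁻ y, a.s y ∂(a.taboo ^ i) z ∂a.green x := by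
        unfold occupation
        rw [lintegral_finsetSum]
        exact fun t _ => a.measurable_s.lintegral_kernel
    _ ≤ ∑ i ∈ Finset.range (n + 1), 1 := Finset.sum_le_sum fun i _ => a.green_pow_taboo_le i x
    _ = _ := by simp

theorem green_occupation_le (n : ℕ) (x : E) :
    ∫⁻ z, occupation P a.s n z ∂a.green x ≤ (n : ℝ≥0∞) * n := by
  unfold occupation
  rw [lintegral_finsetSum _ fun t _ => a.measurable_s.lintegral_kernel]
  calc _ ≤ ∑ t ∈ Finset.range n, (n : ℝ≥0∞) := by
        refine Finset.sum_le_sum fun t ht => (a.green_pow_le t x).trans ?_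
        exact_mod_cast Nat.succ_le_of_lt (Finset.mem_range.1 ht)
    _ = _ := by simp

theorem lintegral_invMeasure_le {f : E → ℝ≥0∞} (hf : Measurable f) {K : ℝ≥0∞}
    (h : ∀ x, ∫⁻ y, f y ∂a.green x ≤ K) : ∫⁻ y, f y ∂a.invMeasure ≤ K := by
  have := a.isProb
  rw [a.lintegral_invMeasure hf]
  calc _ ≤ ∫⁻ _, K ∂a.ν := lintegral_mono h
    _ = K := by simp

end Atom

/-! ### Path space, the Markov property and second moments. -/

section ChainLaw

variable {E : Type*} [MeasurableSpace E] (P : Kernel E E) [IsMarkovKernel P] (lam : Measure E)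

instance isProbabilityMeasure_chainLaw [IsProbabilityMeasure lam] : IsProbabilityMeasure (chainLaw P lam) := by
  unfold chainLaw; infer_instance

theorem isMarkovChain_chainLaw [IsProbabilityMeasure lam] :
    IsMarkovChain P (fun t (ω : ℕ → E) => ω t) (chainLaw P lam) where
  measurable t := measurable_pi_apply t
  markov _ := Kernel.map_frestrictLe_trajMeasure_compProd_eq_map_trajMeasure.symm

theorem map_chainLaw_zero : (chainLaw P lam).map (fun ω => ω 0) = lam := by
  have h : (fun ω : ℕ → E => ω 0) =
      (MeasurableEquiv.piUnique (fun _ : Finset.Iic 0 => E)) ∘ Preorder.frestrictLe (π := fun _ => E) 0 := by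
    ext ω; rfl
  rw [h, ← Measure.map_map (by fun_prop) (by fun_prop), chainLaw, Kernel.trajMeasure,
    Measure.map_comp _ _ (by fun_prop), Kernel.traj_map_frestrictLe, Kernel.partialTraj_self,
    Measure.id_comp, Measure.map_map (by fun_prop) (by fun_prop)]
  exact Measure.map_id

end ChainLaw

/-- The right side counts the diagonal l = 0 twice, so it exceeds the square by a sum of squares. -/
theorem sq_sum_le_two_mul_sum (u : ℕ → ℝ) (n : ℕ) :
    (∑ t ∈ Finset.range n, u t) ^ 2 ≤
      2 * ∑ i ∈ Finset.range n, ∑ l ∈ Finset.range (n - i), u i * u (i + l) := by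
  have h (n : ℕ) : (∑ t ∈ Finset.range n, u t) ^ 2 + ∑ t ∈ Finset.range n, u t ^ 2 =
      2 * ∑ i ∈ Finset.range n, ∑ l ∈ Finset.range (n - i), u i * u (i + l) := by
    induction n with
    | zero => simp
    | succ n ih =>
      have h1 : ∑ i ∈ Finset.range n, ∑ l ∈ Finset.range (n + 1 - i), u i * u (i + l) =
          ∑ i ∈ Finset.range n, ∑ l ∈ Finset.range (n - i), u i * u (i + l) +
          (∑ i ∈ Finset.range n, u i) * u n := by
        rw [Finset.sum_mul, ← Finset.sum_add_distrib]
        refine Finset.sum_congr rfl fun i hi => ?_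
        have hi' := Finset.mem_range.1 hi
        rw [show n + 1 - i = (n - i) + 1 by omega, Finset.sum_range_succ,
          show i + (n - i) = n by omega]
      rw [Finset.sum_range_succ, Finset.sum_range_succ, Finset.sum_range_succ _ n, h1]
      simp only [Nat.add_sub_cancel_left, Finset.range_one, Finset.sum_singleton, add_zero]
      linear_combination ih
  rw [← h n]
  exact le_add_of_nonneg_right (Finset.sum_nonneg fun t _ => sq_nonneg _)

namespace IsMarkovChain

variable {E Ω : Type*} [MeasurableSpace E] [MeasurableSpace Ω] {P : Kernel E E} [IsMarkovKernel P]
  {Z : ℕ → Ω → E} {μ : Measure Ω} [IsProbabilityMeasure μ]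

/-- The Markov property for nonnegative functions of the history and of the next state. -/
theorem lintegral_history (hZ : IsMarkovChain P Z μ) (n : ℕ)
    {F : (Finset.Iic n → E) × E → ℝ≥0∞} (hF : Measurable F) :
    ∫⁻ ω, F ((fun i => Z i ω), Z (n + 1) ω) ∂μ =
      ∫⁻ ω, ∫⁻ y, F ((fun i => Z i ω), y) ∂P (Z n ω) ∂μ := by
  have hm := hZ.measurable
  have h1 : Measurable fun ω => (fun i : Finset.Iic n => Z i ω) :=
    measurable_pi_lambda _ fun i => hm i
  have : IsProbabilityMeasure (μ.map fun ω => (fun i : Finset.Iic n => Z i ω)) :=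
    Measure.isProbabilityMeasure_map h1.aemeasurable
  rw [← lintegral_map (f := F) (μ := μ)
    (g := fun ω => ((fun i : Finset.Iic n => Z i ω), Z (n + 1) ω)) hF (h1.prodMk (hm _)),
    hZ.markov n, Measure.lintegral_compProd hF,
    lintegral_map (Measurable.lintegral_kernel_prod_right' hF) h1]
  rfl

theorem lintegral_mul (hZ : IsMarkovChain P Z μ) (i l : ℕ) {f g : E → ℝ≥0∞} (hf : Measurable f)
    (hg : Measurable g) :
    ∫⁻ ω, f (Z i ω) * g (Z (i + l) ω) ∂μ =
      ∫⁻ ω, f (Z i ω) * ∫⁻ y, g y ∂(P ^ l) (Z i ω) ∂μ := by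
  induction l generalizing g with
  | zero => simp_rw [lintegral_pow_zero P _ hg]; rfl
  | succ l ih =>
    have hi : i ∈ Finset.Iic (i + l) := Finset.mem_Iic.2 (by omega)
    have h := hZ.lintegral_history (i + l)
      (F := fun p => f (p.1 ⟨i, hi⟩) * g p.2)
      ((hf.comp ((measurable_pi_apply _).comp measurable_fst)).mul (hg.comp measurable_snd))
    simp only [lintegral_const_mul _ hg] at h
    rw [← add_assoc, h, ih hg.lintegral_kernel]
    simp_rw [lintegral_pow_succ' P _ _ hg]

theorem lintegral_eq (hZ : IsMarkovChain P Z μ) (t : ℕ) {f : E → ℝ≥0∞} (hf : Measurable f) :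
    ∫⁻ ω, f (Z t ω) ∂μ = ∫⁻ x, ∫⁻ y, f y ∂(P ^ t) x ∂μ.map (Z 0) := by
  rw [lintegral_map hf.lintegral_kernel (hZ.measurable 0)]
  simpa using hZ.lintegral_mul 0 t (f := fun _ => 1) measurable_const hf

theorem lintegral_sum_eq (hZ : IsMarkovChain P Z μ) (n : ℕ) {f : E → ℝ≥0∞} (hf : Measurable f) :
    ∫⁻ ω, ∑ t ∈ Finset.range n, f (Z t ω) ∂μ = ∫⁻ x, occupation P f n x ∂μ.map (Z 0) := by
  have hft (t : ℕ) : Measurable fun ω => f (Z t ω) := hf.comp (hZ.measurable t)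
  unfold occupation
  rw [lintegral_finsetSum _ fun t _ => hft t,
    lintegral_finsetSum _ fun t _ => hf.lintegral_kernel]
  exact Finset.sum_congr rfl fun t _ => hZ.lintegral_eq t hf

theorem map_pair (hZ : IsMarkovChain P Z μ) (i l : ℕ) :
    μ.map (fun ω => (Z i ω, Z (i + l) ω)) = μ.map (Z i) ⊗ₘ (P ^ l) := by
  have hm := hZ.measurable
  have : IsProbabilityMeasure (μ.map (Z i)) :=
    Measure.isProbabilityMeasure_map (hm i).aemeasurable
  have : IsProbabilityMeasure (μ.map (fun ω => (Z i ω, Z (i + l) ω))) :=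
    Measure.isProbabilityMeasure_map ((hm i).prodMk (hm _)).aemeasurable
  refine Measure.ext_prod fun {s t} hs ht => ?_
  rw [Measure.map_apply ((hm i).prodMk (hm _)) (hs.prod ht), Measure.compProd_apply_prod hs ht,
    ← lintegral_indicator hs, lintegral_map ((Kernel.measurable_coe _ ht).indicator hs) (hm i)]
  have h := hZ.lintegral_mul i l (f := s.indicator 1) (g := t.indicator 1)
    (measurable_one.indicator hs) (measurable_one.indicator ht)
  have h1 : ∫⁻ ω, s.indicator (fun x => ((P ^ l) x) t) (Z i ω) ∂μ =
      ∫⁻ ω, s.indicator 1 (Z i ω) * ∫⁻ y, t.indicator 1 y ∂(P ^ l) (Z i ω) ∂μ := by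
    refine lintegral_congr fun ω => ?_
    rw [lintegral_indicator_one ht]
    by_cases hω : Z i ω ∈ s <;> simp [hω]
  rw [h1, ← h, ← lintegral_indicator_one (((hm i).prodMk (hm _)) (hs.prod ht))]
  refine lintegral_congr fun ω => ?_
  by_cases h1 : Z i ω ∈ s <;> by_cases h2 : Z (i + l) ω ∈ t <;> simp [h1, h2]

theorem integral_mul (hZ : IsMarkovChain P Z μ) (i l : ℕ) {h : E → ℝ} (hh : Measurable h) {C : ℝ}
    (hC : ∀ x, |h x| ≤ C) :
    ∫ ω, h (Z i ω) * h (Z (i + l) ω) ∂μ =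
      ∫ ω, h (Z i ω) * ∫ y, h y ∂(P ^ l) (Z i ω) ∂μ := by
  have hm := hZ.measurable
  have : IsProbabilityMeasure (μ.map (Z i)) :=
    Measure.isProbabilityMeasure_map (hm i).aemeasurable
  have hF : Measurable fun p : E × E => h p.1 * h p.2 :=
    (hh.comp measurable_fst).mul (hh.comp measurable_snd)
  have h1 := integral_map (μ := μ) (φ := fun ω => (Z i ω, Z (i + l) ω))
    (f := fun p : E × E => h p.1 * h p.2) ((hm i).prodMk (hm _)).aemeasurable
    hF.aestronglyMeasurable
  rw [← h1, hZ.map_pair, Measure.integral_compProd]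
  · simp only [integral_const_mul]
    rw [integral_map (hm i).aemeasurable]
    exact (hh.stronglyMeasurable.mul
      (StronglyMeasurable.integral_kernel hh.stronglyMeasurable)).aestronglyMeasurable
  · refine Integrable.of_bound hF.aestronglyMeasurable (C * C) (Eventually.of_forall fun p => ?_)
    rw [Real.norm_eq_abs, abs_mul]
    exact mul_le_mul (hC _) (hC _) (abs_nonneg _) ((abs_nonneg _).trans (hC p.1))

/-- Second moment bound for additive functionals whose expected partial sums are bounded. -/
theorem integral_sum_sq_le (hZ : IsMarkovChain P Z μ) {h : E → ℝ} (hh : Measurable h) {C : ℝ}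
    (hC : ∀ x, |h x| ≤ C) {K : ℝ} (n : ℕ)
    (hK : ∀ m ≤ n, ∀ x, |∑ l ∈ Finset.range m, ∫ y, h y ∂(P ^ l) x| ≤ K) :
    ∫ ω, (∑ t ∈ Finset.range n, h (Z t ω)) ^ 2 ∂μ ≤
      2 * K * ∑ t ∈ Finset.range n, ∫ ω, |h (Z t ω)| ∂μ := by
  have hm (t : ℕ) : Measurable fun ω => h (Z t ω) := hh.comp (hZ.measurable t)
  have hint (i j : ℕ) : Integrable (fun ω => h (Z i ω) * h (Z j ω)) μ := by
    refine Integrable.of_bound ((hm i).mul (hm j)).aestronglyMeasurable (C * C)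
      (Eventually.of_forall fun ω => ?_)
    rw [Real.norm_eq_abs, abs_mul]
    exact mul_le_mul (hC _) (hC _) (abs_nonneg _) ((abs_nonneg _).trans (hC (Z i ω)))
  have hH (m l : ℕ) : Integrable (fun ω => h (Z m ω) * ∫ y, h y ∂(P ^ l) (Z m ω)) μ := by
    refine Integrable.of_bound ((hm m).aestronglyMeasurable.mul
      ((StronglyMeasurable.integral_kernel hh.stronglyMeasurable).comp_measurable
        (hZ.measurable m)).aestronglyMeasurable) (C * C) (Eventually.of_forall fun ω => ?_)
    rw [Real.norm_eq_abs, abs_mul]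
    refine mul_le_mul (hC _) ?_ (abs_nonneg _) ((abs_nonneg _).trans (hC (Z m ω)))
    have := norm_integral_le_of_norm_le_const (μ := (P ^ l) (Z m ω)) (f := h) (C := C)
      (Eventually.of_forall fun y => hC y)
    simpa using this
  calc ∫ ω, (∑ t ∈ Finset.range n, h (Z t ω)) ^ 2 ∂μ
      ≤ ∫ ω, 2 * ∑ i ∈ Finset.range n, ∑ l ∈ Finset.range (n - i),
          h (Z i ω) * h (Z (i + l) ω) ∂μ := by
        refine integral_mono_of_nonneg (Eventually.of_forall fun ω => sq_nonneg _) ?_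
          (Eventually.of_forall fun ω => sq_sum_le_two_mul_sum _ n)
        exact (integrable_finsetSum _ fun i _ => integrable_finsetSum _ fun l _ =>
          hint i (i + l)).const_mul 2
    _ = 2 * ∑ i ∈ Finset.range n,
          ∫ ω, h (Z i ω) * ∑ l ∈ Finset.range (n - i), ∫ y, h y ∂(P ^ l) (Z i ω) ∂μ := by
        rw [integral_const_mul, integral_finsetSum _ fun i _ => integrable_finsetSum _ fun l _ =>
          hint i (i + l)]
        congr 1
        refine Finset.sum_congr rfl fun i _ => ?_
        simp_rw [Finset.mul_sum]
        rw [integral_finsetSum _ fun l _ => hint i (i + l), integral_finsetSum _ fun l _ => hH i l]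
        exact Finset.sum_congr rfl fun l _ => hZ.integral_mul i l hh hC
    -- The inner sum is the expected future sum given the state at time i; its horizon n - i is at
    -- most n, so it is bounded by K.
    _ ≤ 2 * ∑ i ∈ Finset.range n, ∫ ω, K * |h (Z i ω)| ∂μ := by
        refine mul_le_mul_of_nonneg_left (Finset.sum_le_sum fun i hi =>
          integral_mono ?_ ?_ fun ω => ?_) two_pos.le
        · simp_rw [Finset.mul_sum]
          exact integrable_finsetSum _ fun l _ => hH i l
        · exact (Integrable.of_bound (hm i).abs.aestronglyMeasurable C
            (Eventually.of_forall fun ω => by simpa using hC _)).const_mul K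
        · refine (le_abs_self _).trans ?_
          rw [abs_mul, mul_comm]
          gcongr
          exact hK _ (by omega) _
    _ = _ := by simp_rw [integral_const_mul]; rw [← Finset.mul_sum]; ring

end IsMarkovChain

/-! ### Expectations of functions of path sums, as functions of the starting point. -/

section SumLaw

variable {E : Type*} [MeasurableSpace E]

/-- The expectation, for the chain started from `x`, of `F (y + S)`, where `S` is the sum of the
values of `h` at the first `n` states. -/
noncomputable def sumLaw (P : Kernel E E) (h : E → ℝ) (F : ℝ → ℝ≥0∞) : ℕ → ℝ → E → ℝ≥0∞
  | 0, y, _ => F y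
  | n + 1, y, x => ∫⁻ z, sumLaw P h F n (y + h x) z ∂P x

variable {P : Kernel E E} [IsMarkovKernel P] {h : E → ℝ} {F : ℝ → ℝ≥0∞}

theorem measurable_sumLaw (hh : Measurable h) (hF : Measurable F) (n : ℕ) :
    Measurable fun p : ℝ × E => sumLaw P h F n p.1 p.2 := by
  induction n with
  | zero => exact hF.comp measurable_fst
  | succ n ih =>
    exact Measurable.lintegral_kernel_prod_right' (κ := P.comap Prod.snd measurable_snd)
      (f := fun q : (ℝ × E) × E => sumLaw P h F n (q.1.1 + h q.1.2) q.2)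
      (ih.comp (((measurable_fst.comp measurable_fst).add
        (hh.comp (measurable_snd.comp measurable_fst))).prodMk measurable_snd))

theorem sumLaw_le_one (hF1 : ∀ y, F y ≤ 1) (n : ℕ) (y : ℝ) (x : E) : sumLaw P h F n y x ≤ 1 := by
  induction n generalizing y x with
  | zero => exact hF1 y
  | succ n ih =>
    calc _ ≤ ∫⁻ _, 1 ∂P x := lintegral_mono fun z => ih _ z
      _ = 1 := by simp

theorem IsMarkovChain.lintegral_sumLaw {Ω : Type*} [MeasurableSpace Ω] {Z : ℕ → Ω → E}
    {μ : Measure Ω} [IsProbabilityMeasure μ] (hZ : IsMarkovChain P Z μ) (hh : Measurable h)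
    (hF : Measurable F) (n : ℕ) :
    ∫⁻ ω, F (∑ t ∈ Finset.range n, h (Z t ω)) ∂μ = ∫⁻ x, sumLaw P h F n 0 x ∂μ.map (Z 0) := by
  -- Generalized to an intermediate time: k states are read off the path and the remaining n are
  -- integrated out.
  have key : ∀ n k : ℕ,
      ∫⁻ ω, sumLaw P h F n (∑ t ∈ Finset.range k, h (Z t ω)) (Z k ω) ∂μ =
        ∫⁻ ω, F (∑ t ∈ Finset.range (k + n), h (Z t ω)) ∂μ := by
    intro n
    induction n with
    | zero => intro k; rfl
    | succ n ih =>
      intro k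
      have hsum (ω : Ω) : ∑ t ∈ Finset.range (k + 1), h (Z t ω) =
          ∑ t ∈ (Finset.Iic k).attach, h (Z t ω) := by
        rw [Finset.sum_attach (Finset.Iic k) (fun t => h (Z t ω)), Nat.range_succ_eq_Iic]
      have hm : Measurable fun p : (Finset.Iic k → E) × E =>
          sumLaw P h F n (∑ t ∈ (Finset.Iic k).attach, h (p.1 t)) p.2 := by
        refine (measurable_sumLaw hh hF n).comp (Measurable.prodMk ?_ measurable_snd)
        refine Finset.measurable_fun_sum (Finset.Iic k).attach
          (f := fun t (p : (Finset.Iic k → E) × E) => h (p.1 t)) fun t _ => ?_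
        exact hh.comp ((measurable_pi_apply t).comp measurable_fst)
      have h1 := hZ.lintegral_history k hm
      simp only [← hsum] at h1
      rw [show k + (n + 1) = k + 1 + n by ring, ← ih (k + 1), h1]
      simp only [sumLaw, ← Finset.sum_range_succ]
  have hm : Measurable (sumLaw P h F n 0) :=
    (measurable_sumLaw hh hF n).comp measurable_prodMk_left
  rw [lintegral_map hm (hZ.measurable 0)]
  simpa using (key n 0).symm

variable {C : ℝ} {δ : ℝ≥0∞}

theorem sumLaw_le_add (hF : ∀ y z, |y - z| ≤ C → F y ≤ F z + δ) (n : ℕ) (y z : ℝ)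
    (hyz : |y - z| ≤ C) (x : E) : sumLaw P h F n y x ≤ sumLaw P h F n z x + δ := by
  induction n generalizing y z x with
  | zero => exact hF y z hyz
  | succ n ih =>
    calc _ ≤ ∫⁻ w, (sumLaw P h F n (z + h x) w + δ) ∂P x :=
          lintegral_mono fun w => ih _ _ (by simpa using hyz) w
      _ = _ := by rw [lintegral_add_right _ measurable_const]; simp [sumLaw]

theorem sumLaw_le_succ (hF : ∀ y z, |y - z| ≤ C → F y ≤ F z + δ) (hC : ∀ x, |h x| ≤ C) (n : ℕ)
    (y : ℝ) (x : E) : sumLaw P h F n y x ≤ sumLaw P h F (n + 1) y x + δ := by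
  induction n generalizing y x with
  | zero =>
    have : F y ≤ F (y + h x) + δ := hF _ _ (by simpa using hC x)
    simpa [sumLaw] using this
  | succ n ih =>
    calc _ ≤ ∫⁻ w, (sumLaw P h F (n + 1) (y + h x) w + δ) ∂P x :=
          lintegral_mono fun w => ih _ w
      _ = _ := by rw [lintegral_add_right _ measurable_const]; simp [sumLaw]

/-- Shifting the window by one step drops the first summand and appends one at the end. Each change
moves the sum by at most C, hence the expectation by at most δ. -/
theorem sumLaw_le_lintegral (hF : ∀ y z, |y - z| ≤ C → F y ≤ F z + δ) (hC : ∀ x, |h x| ≤ C)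
    (n : ℕ) (x : E) :
    sumLaw P h F n 0 x ≤ ∫⁻ w, sumLaw P h F n 0 w ∂P x + 2 * δ := by
  calc sumLaw P h F n 0 x ≤ sumLaw P h F (n + 1) 0 x + δ := sumLaw_le_succ hF hC n 0 x
    _ ≤ ∫⁻ w, (sumLaw P h F n 0 w + δ) ∂P x + δ := by
        gcongr
        exact lintegral_mono fun w => sumLaw_le_add hF n _ _ (by simpa using hC x) w
    _ = _ := by rw [lintegral_add_right _ measurable_const]; simp; ring

end SumLaw

/-! ### Consequences of Harris recurrence: certain regeneration and renewal asymptotics. -/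

section Harris

variable {E : Type*} [MeasurableSpace E] {φ : Measure E} {P : Kernel E E} [IsMarkovKernel P]

theorem IsPosFun.exists_pos_le {f : E → ℝ≥0∞} (hf : IsPosFun φ f) :
    ∃ ε : ℝ≥0∞, ε ≠ 0 ∧ 0 < φ {x | ε ≤ f x} := by
  have h : {x | 0 < f x} ⊆ ⋃ k : ℕ, {x | (k : ℝ≥0∞)⁻¹ ≤ f x} := by
    intro x hx
    obtain ⟨k, hk⟩ := ENNReal.exists_inv_nat_lt hx.ne'
    exact Set.mem_iUnion.2 ⟨k, hk.le⟩
  by_contra! hcon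
  refine hf.2.ne' (measure_mono_null h (measure_iUnion_null fun k => ?_))
  exact le_antisymm (hcon _ (ENNReal.inv_ne_zero.2 (ENNReal.natCast_ne_top k))) zero_le

theorem IsHarrisRecurrent.iSup_occupation (hP : IsHarrisRecurrent φ P) {f : E → ℝ≥0∞}
    (hf : IsPosFun φ f) (x : E) : ⨆ n, occupation P f n x = ∞ := by
  -- Infinitely many visits to {f > 0} would not make the sum diverge; visits to a level set {f ≥ ε}
  -- do.
  obtain ⟨ε, hε, hφ⟩ := hf.exists_pos_le
  have hZ := isMarkovChain_chainLaw P (Measure.dirac x)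
  have h1 : ⨆ n, occupation P f n x =
      ∫⁻ ω, ∑' t, f (ω t) ∂chainLaw P (Measure.dirac x) := by
    have hft (t : ℕ) : Measurable fun ω : ℕ → E => f (ω t) := hf.1.comp (hZ.measurable t)
    rw [lintegral_tsum fun t => (hft t).aemeasurable,
      ENNReal.tsum_eq_iSup_nat]
    refine iSup_congr fun n => Finset.sum_congr rfl fun t _ => ?_
    rw [hZ.lintegral_eq t hf.1, map_chainLaw_zero, lintegral_dirac' _ hf.1.lintegral_kernel]
  have h2 : ∀ᵐ ω ∂chainLaw P (Measure.dirac x), ∑' t, f (ω t) = ∞ := by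
    filter_upwards [hP.recurrent _ (measurableSet_le measurable_const hf.1) hφ x] with ω hω
    by_contra hne
    exact Nat.frequently_atTop_iff_infinite.1 hω (ENNReal.finite_const_le_of_tsum_ne_top hne hε)
  rw [h1, lintegral_congr_ae h2]
  simp

theorem IsHarrisRecurrent.iSup_lintegral_occupation (hP : IsHarrisRecurrent φ P) {f : E → ℝ≥0∞}
    (hf : IsPosFun φ f) (lam : Measure E) [IsProbabilityMeasure lam] :
    ⨆ n, ∫⁻ x, occupation P f n x ∂lam = ∞ := by
  rw [← lintegral_iSup (fun n => measurable_occupation P hf.1 n)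
    (fun m n hmn x => occupation_mono P f x hmn)]
  simp_rw [hP.iSup_occupation hf]
  simp

end Harris

namespace Atom

variable {E : Type*} [MeasurableSpace E] {φ : Measure E} {P : Kernel E E} (a : Atom φ P)

theorem lintegral_pow_limit {h : E → ℝ≥0∞} (hm : Measurable h)
    (hh : ∀ x, ∫⁻ y, h y ∂P x = h x + (∫⁻ y, h y ∂a.ν) * a.s x) (n : ℕ) (x : E) :
    ∫⁻ y, h y ∂(P ^ n) x = h x + (∫⁻ y, h y ∂a.ν) * occupation P a.s n x := by
  induction n with
  | zero => rw [lintegral_pow_zero _ _ hm, occupation_zero]; simp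
  | succ n ih =>
    rw [lintegral_pow_succ' _ _ _ hm, occupation_succ]
    simp_rw [hh]
    rw [lintegral_add_left hm, lintegral_const_mul _ a.measurable_s, ih]; ring

variable [IsMarkovKernel P]

/-- The limit h of Q^n 1 satisfies Q h = h, so P^n h = h + ν(h) U_n s. This is bounded by 1 while
U_n s diverges, hence ν(h) = 0 and h is P-harmonic. The set {h = 0} is nonempty and absorbing, thus
φ-full by irreducibility; Harris recurrence brings every path into it, so h along the path tends to
0 while its mean stays equal to h x. -/
theorem iInf_taboo_pow (hP : IsHarrisRecurrent φ P) (x : E) :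
    ⨅ n, (a.taboo ^ n) x Set.univ = 0 := by
  have := a.isProb
  set h : E → ℝ≥0∞ := fun x => ⨅ n, (a.taboo ^ n) x Set.univ with hdef
  have hmn (n : ℕ) : Measurable fun x => (a.taboo ^ n) x Set.univ :=
    Kernel.measurable_coe _ MeasurableSet.univ
  have hm : Measurable h := Measurable.iInf hmn
  have h1 (x : E) : h x ≤ 1 := (iInf_le _ 0).trans (a.taboo_pow_univ_le_one 0 x)
  have hQ (x : E) : ∫⁻ y, h y ∂a.taboo x = h x := by
    have hsucc (n : ℕ) :
        ∫⁻ y, (a.taboo ^ n) y Set.univ ∂a.taboo x = (a.taboo ^ (n + 1)) x Set.univ := by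
      simpa using (lintegral_pow_succ a.taboo n x (f := fun _ => 1) measurable_const).symm
    rw [hdef, lintegral_iInf hmn (fun i j hij y => a.taboo_pow_univ_antitone y hij)]
    · simp_rw [hsucc]
      exact (a.taboo_pow_univ_antitone x).iInf_nat_add 1
    · rw [hsucc]
      exact ((a.taboo_pow_univ_le_one _ x).trans_lt ENNReal.one_lt_top).ne
  have hPh (x : E) : ∫⁻ y, h y ∂P x = h x + (∫⁻ y, h y ∂a.ν) * a.s x := by
    rw [a.lintegral_eq, hQ, mul_comm]
  have hν : ∫⁻ y, h y ∂a.ν = 0 := by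
    by_contra hne
    have hle : (∫⁻ y, h y ∂a.ν) * ⨆ n, occupation P a.s n x ≤ 1 := by
      rw [ENNReal.mul_iSup]
      refine iSup_le fun n => ?_
      calc _ ≤ ∫⁻ y, h y ∂(P ^ n) x := by rw [a.lintegral_pow_limit hm hPh]; exact le_add_self
        _ ≤ ∫⁻ _, 1 ∂(P ^ n) x := lintegral_mono h1
        _ = 1 := by simp
    rw [hP.iSup_occupation a.isPosFun, ENNReal.mul_top hne] at hle
    exact absurd hle (by simp)
  have hpow (n : ℕ) (x : E) : ∫⁻ y, h y ∂(P ^ n) x = h x := by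
    rw [a.lintegral_pow_limit hm hPh, hν]; simp
  have hB : MeasurableSet {x | h x = 0} := hm (measurableSet_singleton 0)
  have hnull (n : ℕ) (x : E) (hx : h x = 0) : (P ^ n) x {x | h x = 0}ᶜ = 0 := by
    have := hpow n x
    rw [hx, lintegral_eq_zero_iff hm] at this
    exact this
  have hφ0 : φ {x | h x = 0}ᶜ = 0 := by
    by_contra hne
    obtain ⟨x₀, hx₀⟩ : ∃ x₀, h x₀ = 0 := ((lintegral_eq_zero_iff hm).1 hν).exists
    obtain ⟨n, hn⟩ := hP.irreducible.irreducible hB.compl (pos_iff_ne_zero.2 hne) x₀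
    exact hn.ne' (hnull n x₀ hx₀)
  have hφB : 0 < φ {x | h x = 0} := by
    refine pos_iff_ne_zero.2 fun h0 => hP.nontrivial ?_
    rw [← Measure.measure_univ_eq_zero, ← Set.union_compl_self {x | h x = 0}]
    exact measure_union_null h0 hφ0
  have hZ := isMarkovChain_chainLaw P (Measure.dirac x)
  have habs : ∀ᵐ ω ∂chainLaw P (Measure.dirac x), ∀ t, h (ω t) = 0 → h (ω (t + 1)) = 0 := by
    rw [ae_all_iff]
    intro t
    have hz := hZ.lintegral_mul t 1 (f := Set.indicator {x | h x = 0} 1)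
      (measurable_one.indicator hB) hm
    have hrhs : ∫⁻ ω : ℕ → E, Set.indicator {x | h x = 0} 1 (ω t) *
        ∫⁻ y, h y ∂(P ^ 1) (ω t) ∂chainLaw P (Measure.dirac x) = 0 := by
      rw [lintegral_eq_zero_iff' (Measurable.aemeasurable ?_)]
      · refine Eventually.of_forall fun ω => ?_
        simp only [hpow]
        by_cases hω : h (ω t) = 0 <;> simp [hω]
      · exact ((measurable_one.indicator hB).comp (hZ.measurable t)).mul
          (hm.lintegral_kernel.comp (hZ.measurable t))
    rw [hrhs, lintegral_eq_zero_iff' (Measurable.aemeasurable ?_)] at hz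
    · filter_upwards [hz] with ω hω h0
      simpa [h0] using hω
    · exact ((measurable_one.indicator hB).comp (hZ.measurable t)).mul
          (hm.comp (hZ.measurable _))
  have hev : ∀ᵐ ω ∂chainLaw P (Measure.dirac x), Tendsto (fun t => h (ω t)) atTop (𝓝 0) := by
    filter_upwards [habs, hP.recurrent _ hB hφB x] with ω h2 h3
    obtain ⟨t₀, ht₀⟩ := h3.exists
    refine tendsto_const_nhds.congr' ?_
    filter_upwards [eventually_ge_atTop t₀] with t ht
    induction t, ht using Nat.le_induction with
    | base => exact ht₀.symm
    | succ t _ ih => exact (h2 t ih.symm).symm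
  have hlim : Tendsto (fun t : ℕ => ∫⁻ ω : ℕ → E, h (ω t) ∂chainLaw P (Measure.dirac x)) atTop
      (𝓝 (∫⁻ _ : ℕ → E, 0 ∂chainLaw P (Measure.dirac x))) :=
    tendsto_lintegral_of_dominated_convergence (fun _ => 1)
      (fun t => hm.comp (hZ.measurable t)) (fun t => Eventually.of_forall fun ω => h1 _)
      (by simp) hev
  have hconst (t : ℕ) : ∫⁻ ω : ℕ → E, h (ω t) ∂chainLaw P (Measure.dirac x) = h x := by
    rw [hZ.lintegral_eq t hm, map_chainLaw_zero, lintegral_dirac' _ hm.lintegral_kernel, hpow]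
  simp only [hconst, lintegral_zero] at hlim
  exact tendsto_nhds_unique tendsto_const_nhds hlim

theorem tendsto_taboo_pow (hP : IsHarrisRecurrent φ P) (lam : Measure E)
    [IsProbabilityMeasure lam] :
    Tendsto (fun n => ∫⁻ x, (a.taboo ^ n) x Set.univ ∂lam) atTop (𝓝 0) := by
  have h : Tendsto (fun n => ∫⁻ x, (a.taboo ^ n) x Set.univ ∂lam) atTop (𝓝 (∫⁻ _, 0 ∂lam)) := by
    refine tendsto_lintegral_of_dominated_convergence (fun _ => 1)
      (fun n => Kernel.measurable_coe _ MeasurableSet.univ)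
      (fun n => Eventually.of_forall fun x => a.taboo_pow_univ_le_one n x) (by simp)
      (Eventually.of_forall fun x => ?_)
    rw [← a.iInf_taboo_pow hP x]
    exact tendsto_atTop_iInf (a.taboo_pow_univ_antitone x)
  simpa using h

theorem tendsto_renewal (hP : IsHarrisRecurrent φ P) :
    Tendsto (fun n => (a.renewal n).toReal) atTop atTop := by
  have := a.isProb
  have h : Tendsto a.renewal atTop (𝓝 ∞) := by
    rw [← hP.iSup_lintegral_occupation a.isPosFun a.ν]
    exact tendsto_atTop_iSup a.renewal_mono
  refine tendsto_atTop.2 fun b => ?_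
  filter_upwards [h.eventually (lt_mem_nhds ENNReal.ofReal_lt_top)] with n hn
  exact (ENNReal.ofReal_le_iff_le_toReal (a.renewal_ne_top n)).1 hn.le

theorem invMeasure_pos (hP : IsHarrisRecurrent φ P) {f : E → ℝ≥0∞} (hf : IsPosFun φ f) :
    0 < ∫⁻ y, f y ∂a.invMeasure := by
  have := a.isProb
  refine pos_iff_ne_zero.2 fun h0 => ?_
  have h := hP.iSup_lintegral_occupation hf a.ν
  have hz (n : ℕ) : ∫⁻ x, occupation P f n x ∂a.ν = 0 := by
    have := a.lintegral_nu_occupation_le hf.1 n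
    rw [h0, zero_mul] at this
    exact le_antisymm this zero_le
  simp [hz] at h

/-- Some P^j s has positive integral against the minorizing measure. Composing with the minorization
bounds f by a multiple of P^(j+m) s, whose potential is at most j + m + 1. -/
theorem exists_green_le_of_isSmallFun (hP : IsHarrisRecurrent φ P) {f : E → ℝ≥0∞}
    (hf : IsSmallFun φ P f) : ∃ K : ℝ≥0∞, K ≠ ∞ ∧ ∀ x, ∫⁻ y, f y ∂a.green x ≤ K := by
  obtain ⟨hpos, lam, b, m, hlam, hb, -, hmin⟩ := hf
  obtain ⟨j, hj⟩ : ∃ j, ∫⁻ x, ∫⁻ y, a.s y ∂(P ^ j) x ∂lam ≠ 0 := by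
    by_contra! hcon
    have h := lintegral_iSup (μ := lam) (fun n => measurable_occupation P a.measurable_s n)
      (fun m n hmn x => occupation_mono P a.s x hmn)
    simp_rw [hP.iSup_occupation a.isPosFun] at h
    have hz (n : ℕ) : ∫⁻ x, occupation P a.s n x ∂lam = 0 := by
      unfold occupation
      rw [lintegral_finsetSum _ fun t _ => a.measurable_s.lintegral_kernel]
      exact Finset.sum_eq_zero fun t _ => hcon t
    simp [hz, hlam] at h
  set I := ∫⁻ x, ∫⁻ y, a.s y ∂(P ^ j) x ∂lam
  -- The minorizing measure may be infinite; capping I at 1 keeps the constant finite and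
  -- invertible.
  set c : ℝ≥0∞ := ENNReal.ofReal b * min I 1
  have hc0 : c ≠ 0 := mul_ne_zero (by simpa using hb) (by simp [hj])
  have hct : c ≠ ∞ :=
    ENNReal.mul_ne_top ENNReal.ofReal_ne_top ((min_le_right _ _).trans_lt ENNReal.one_lt_top).ne
  have hle (x : E) : f x ≤ c⁻¹ * ∫⁻ y, a.s y ∂(P ^ (j + m)) x := by
    have h1 : c * f x ≤ ∫⁻ y, a.s y ∂(P ^ (j + m)) x := by
      rw [lintegral_pow_add _ _ _ _ a.measurable_s]
      calc c * f x ≤ (ENNReal.ofReal b * f x) * I := by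
            rw [mul_right_comm]; gcongr; exact min_le_left _ _
        _ = ∫⁻ y, ∫⁻ z, a.s z ∂(P ^ j) y ∂((ENNReal.ofReal b * f x) • lam) := by
            rw [lintegral_smul_measure, smul_eq_mul]
        _ ≤ _ := lintegral_mono' (hmin x) le_rfl
    rwa [← ENNReal.div_eq_inv_mul, ENNReal.le_div_iff_mul_le (Or.inl hc0) (Or.inl hct), mul_comm]
  refine ⟨c⁻¹ * ((j + m : ℕ) + 1), ENNReal.mul_ne_top (ENNReal.inv_ne_top.2 hc0) (by finiteness),
    fun x => ?_⟩
  calc ∫⁻ y, f y ∂a.green x ≤ ∫⁻ z, c⁻¹ * ∫⁻ y, a.s y ∂(P ^ (j + m)) z ∂a.green x :=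
        lintegral_mono hle
    _ = c⁻¹ * ∫⁻ z, ∫⁻ y, a.s y ∂(P ^ (j + m)) z ∂a.green x :=
        lintegral_const_mul _ a.measurable_s.lintegral_kernel
    _ ≤ _ := by gcongr; exact a.green_pow_le _ x

theorem lintegral_occupation_le_renewal (lam : Measure E) [IsProbabilityMeasure lam] (n : ℕ) :
    ∫⁻ x, occupation P a.s n x ∂lam ≤ 1 + a.renewal n := by
  calc _ ≤ ∫⁻ _, (1 + a.renewal n) ∂lam := lintegral_mono fun x => a.occupation_le_renewal n x
    _ = _ := by simp

/-- The renewal function does not depend asymptotically on the initial distribution. -/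
theorem isEquivalent_renewal (hP : IsHarrisRecurrent φ P) (lam : Measure E)
    [IsProbabilityMeasure lam] :
    Asymptotics.IsEquivalent atTop (fun n => (∫⁻ x, occupation P a.s n x ∂lam).toReal)
      (fun n => (a.renewal n).toReal) := by
  have hup := a.lintegral_occupation_le_renewal lam
  have hne (n : ℕ) : ∫⁻ x, occupation P a.s n x ∂lam ≠ ∞ :=
    ne_top_of_le_ne_top (by simp [a.renewal_ne_top]) (hup n)
  have hQ1 (k : ℕ) : ∫⁻ x, (a.taboo ^ k) x Set.univ ∂lam ≤ 1 := by
    calc _ ≤ ∫⁻ _, 1 ∂lam := lintegral_mono fun x => a.taboo_pow_univ_le_one k x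
      _ = 1 := by simp
  have hlow (n k : ℕ) : (a.renewal n).toReal ≤ (∫⁻ x, occupation P a.s n x ∂lam).toReal + k +
      (a.renewal n).toReal * (∫⁻ x, (a.taboo ^ k) x Set.univ ∂lam).toReal := by
    have h1 : a.renewal n ≤ ∫⁻ x, occupation P a.s n x ∂lam + k +
        a.renewal n * ∫⁻ x, (a.taboo ^ k) x Set.univ ∂lam := by
      have hQm : Measurable fun x => (a.taboo ^ k) x Set.univ :=
        Kernel.measurable_coe _ MeasurableSet.univ
      -- The factor inserted under the integral equals one by `sum_taboo_add`: the mass regenerated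
      -- within k steps plus the mass that has not.
      calc a.renewal n = ∫⁻ x, a.renewal n * (occupation a.taboo a.s k x +
            (a.taboo ^ k) x Set.univ) ∂lam := by simp [a.sum_taboo_add]
        _ ≤ ∫⁻ x, (occupation P a.s n x + k + a.renewal n * (a.taboo ^ k) x Set.univ) ∂lam := by
            refine lintegral_mono fun x => ?_
            rw [mul_add]
            gcongr
            exact le_add_self.trans (a.renewal_mul_le n k x)
        _ = _ := by
            rw [lintegral_add_right _ (hQm.const_mul _), lintegral_const_mul _ hQm,
              lintegral_add_right _ measurable_const]
            simp
    have hfin : ∫⁻ x, (a.taboo ^ k) x Set.univ ∂lam ≠ ∞ :=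
      ne_top_of_le_ne_top ENNReal.one_ne_top (hQ1 k)
    have h2 := ENNReal.toReal_mono (by
      have := hne n; have := a.renewal_ne_top n; finiteness) h1
    rwa [ENNReal.toReal_add (by have := hne n; finiteness)
      (ENNReal.mul_ne_top (a.renewal_ne_top n) hfin), ENNReal.toReal_add (hne n) (by finiteness),
      ENNReal.toReal_mul, ENNReal.toReal_natCast] at h2
  have hup' (n : ℕ) : (∫⁻ x, occupation P a.s n x ∂lam).toReal ≤ 1 + (a.renewal n).toReal := by
    have := ENNReal.toReal_mono (by simp [a.renewal_ne_top]) (hup n)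
    rwa [ENNReal.toReal_add ENNReal.one_ne_top (a.renewal_ne_top n), ENNReal.toReal_one] at this
  have hA := a.tendsto_renewal hP
  rw [Asymptotics.IsEquivalent, Asymptotics.isLittleO_iff]
  intro ε hε
  have hQ : Tendsto (fun k => (∫⁻ x, (a.taboo ^ k) x Set.univ ∂lam).toReal) atTop (𝓝 0) :=
    (ENNReal.tendsto_toReal ENNReal.zero_ne_top).comp (a.tendsto_taboo_pow hP lam)
  obtain ⟨k, hk⟩ := (hQ.eventually (gt_mem_nhds (half_pos hε))).exists
  -- Half of ε absorbs the taboo mass after k steps, the other half the bounded error 1 + k.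
  filter_upwards [hA.eventually_ge_atTop ((1 + k) / (ε / 2))] with n hn
  rw [div_le_iff₀ (half_pos hε)] at hn
  have h0 : 0 ≤ (a.renewal n).toReal := ENNReal.toReal_nonneg
  have h1 := mul_le_mul_of_nonneg_left hk.le h0
  have h2 := hlow n k
  have h3 := hup' n
  have hkn : (0 : ℝ) ≤ k := Nat.cast_nonneg k
  rw [Pi.sub_apply, Real.norm_eq_abs, Real.norm_eq_abs, abs_of_nonneg h0, abs_le]
  constructor <;> nlinarith

/-- Functions with bounded Green potential have, up to a constant factor and a bounded error, the
same expected occupation sums as the atom. -/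
theorem abs_lintegral_occupation_sub_le {f : E → ℝ≥0∞} (hf : Measurable f)
    {K : ℝ≥0∞} (hK : K ≠ ∞) (hG : ∀ x, ∫⁻ y, f y ∂a.green x ≤ K) (lam : Measure E)
    [IsProbabilityMeasure lam] (n : ℕ) :
    |(∫⁻ x, occupation P f n x ∂lam).toReal - (∫⁻ y, f y ∂a.invMeasure).toReal *
      (∫⁻ x, occupation P a.s n x ∂lam).toReal| ≤ K.toReal := by
  set c := ∫⁻ y, f y ∂a.invMeasure
  have hct : c ≠ ∞ := ne_top_of_le_ne_top hK (a.lintegral_invMeasure_le hf hG)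
  have hms := measurable_occupation P a.measurable_s
  have hut : ∫⁻ x, occupation P a.s n x ∂lam ≠ ∞ :=
    ne_top_of_le_ne_top (by simp [a.renewal_ne_top]) (a.lintegral_occupation_le_renewal lam n)
  have hintK : ∫⁻ _, K ∂lam = K := by simp
  have h1 : ∫⁻ x, occupation P f n x ∂lam ≤ K + c * ∫⁻ x, occupation P a.s n x ∂lam := by
    rw [← lintegral_const_mul _ (hms n), ← hintK, ← lintegral_add_left measurable_const]
    refine lintegral_mono fun x => ?_
    calc _ ≤ _ := le_self_add
      _ = _ := a.occupation_add hf n x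
      _ ≤ _ := by gcongr; exact hG x
  have h2 : c * ∫⁻ x, occupation P a.s n x ∂lam ≤ ∫⁻ x, occupation P f n x ∂lam + K := by
    rw [← lintegral_const_mul _ (hms n), ← hintK, ← lintegral_add_right _ measurable_const]
    refine lintegral_mono fun x => ?_
    calc _ ≤ _ := le_add_self
      _ = _ := (a.occupation_add hf n x).symm
      _ ≤ occupation P f n x + ∫⁻ _, K ∂(P ^ n) x := by gcongr with z; exact hG z
      _ = _ := by simp
  have hft : ∫⁻ x, occupation P f n x ∂lam ≠ ∞ := ne_top_of_le_ne_top (by finiteness) h1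
  have e1 := ENNReal.toReal_mono (by finiteness) h1
  have e2 := ENNReal.toReal_mono (by finiteness) h2
  rw [ENNReal.toReal_add hK (by finiteness), ENNReal.toReal_mul] at e1
  rw [ENNReal.toReal_add hft hK, ENNReal.toReal_mul] at e2
  rw [abs_le]; constructor <;> linarith

/-- The bounded error is negligible because π(f) > 0 and the renewal function diverges. -/
theorem isEquivalent_occupation (hP : IsHarrisRecurrent φ P) {f : E → ℝ≥0∞} (hf : IsPosFun φ f)
    {K : ℝ≥0∞} (hK : K ≠ ∞) (hG : ∀ x, ∫⁻ y, f y ∂a.green x ≤ K) (lam : Measure E)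
    [IsProbabilityMeasure lam] :
    Asymptotics.IsEquivalent atTop (fun n => (∫⁻ x, occupation P f n x ∂lam).toReal)
      (fun n => (∫⁻ y, f y ∂a.invMeasure).toReal * (a.renewal n).toReal) := by
  have h3 := a.abs_lintegral_occupation_sub_le hf.1 hK hG lam
  set c := ∫⁻ y, f y ∂a.invMeasure
  have hct : c ≠ ∞ := ne_top_of_le_ne_top hK (a.lintegral_invMeasure_le hf.1 hG)
  have hc : 0 < c.toReal := ENNReal.toReal_pos (a.invMeasure_pos hP hf).ne' hct
  have hA := a.tendsto_renewal hP
  have h4 : Asymptotics.IsEquivalent atTop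
      (fun n => c.toReal * (∫⁻ x, occupation P a.s n x ∂lam).toReal)
      (fun n => c.toReal * (a.renewal n).toReal) :=
    Asymptotics.IsEquivalent.mul Asymptotics.IsEquivalent.refl (a.isEquivalent_renewal hP lam)
  have h5 : (fun n => (∫⁻ x, occupation P f n x ∂lam).toReal -
      c.toReal * (∫⁻ x, occupation P a.s n x ∂lam).toReal) =o[atTop]
      (fun n => c.toReal * (a.renewal n).toReal) := by
    have hb : (fun n => (∫⁻ x, occupation P f n x ∂lam).toReal -
        c.toReal * (∫⁻ x, occupation P a.s n x ∂lam).toReal) =O[atTop] (fun _ => (1 : ℝ)) :=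
      Asymptotics.IsBigO.of_bound K.toReal (Eventually.of_forall fun n => by simpa using h3 n)
    refine hb.trans_isLittleO ?_
    rw [Asymptotics.isLittleO_one_left_iff]
    exact tendsto_norm_atTop_atTop.comp (hA.const_mul_atTop hc)
  have := h5.add_isEquivalent h4
  refine this.congr_left (Eventually.of_forall fun n => ?_)
  simp

end Atom

/-! ### Convergence to zero in probability. -/

section InProbability

variable {Ω : Type*} [MeasurableSpace Ω]

/-- The real random variables `Y n` converge to zero in probability. -/
def InProbZero (μ : Measure Ω) (Y : ℕ → Ω → ℝ) : Prop :=
  Tendsto (fun n => ∫⁻ ω, min 1 (ENNReal.ofReal |Y n ω|) ∂μ) atTop (𝓝 0)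

theorem InProbZero.of_integral_abs {μ : Measure Ω} {Y : ℕ → Ω → ℝ}
    (hY : ∀ n, Integrable (Y n) μ) (h : Tendsto (fun n => ∫ ω, |Y n ω| ∂μ) atTop (𝓝 0)) :
    InProbZero μ Y := by
  have h1 : Tendsto (fun n => ENNReal.ofReal (∫ ω, |Y n ω| ∂μ)) atTop (𝓝 0) := by
    simpa using ENNReal.tendsto_ofReal h
  refine tendsto_of_tendsto_of_tendsto_of_le_of_le tendsto_const_nhds h1 (fun _ => zero_le)
    fun n => ?_
  change _ ≤ ENNReal.ofReal (∫ ω, |Y n ω| ∂μ)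
  rw [ofReal_integral_eq_lintegral_ofReal (hY n).abs (Eventually.of_forall fun ω => abs_nonneg _)]
  exact lintegral_mono fun ω => min_le_right _ _

theorem InProbZero.mono {μ : Measure Ω} {Y Y' : ℕ → Ω → ℝ} (hY : InProbZero μ Y)
    (h : ∀ᶠ n in atTop, ∀ ω, |Y' n ω| ≤ |Y n ω|) : InProbZero μ Y' := by
  refine tendsto_of_tendsto_of_tendsto_of_le_of_le' tendsto_const_nhds hY
    (Eventually.of_forall fun _ => zero_le) ?_
  filter_upwards [h] with n hn
  refine lintegral_mono fun ω => ?_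
  exact min_le_min le_rfl (ENNReal.ofReal_le_ofReal (hn ω))

theorem InProbZero.add {μ : Measure Ω} {Y Y' : ℕ → Ω → ℝ} (hY : InProbZero μ Y)
    (hY' : InProbZero μ Y') (hm : ∀ n, Measurable (Y n)) :
    InProbZero μ (fun n ω => Y n ω + Y' n ω) := by
  have h := Tendsto.add hY hY'
  rw [add_zero] at h
  refine tendsto_of_tendsto_of_tendsto_of_le_of_le tendsto_const_nhds h (fun _ => zero_le)
    fun n => ?_
  simp only
  rw [← lintegral_add_left (measurable_const.min (hm n).abs.ennreal_ofReal)]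
  refine lintegral_mono fun ω => ?_
  have h1 : ENNReal.ofReal |Y n ω + Y' n ω| ≤ ENNReal.ofReal |Y n ω| + ENNReal.ofReal |Y' n ω| := by
    rw [← ENNReal.ofReal_add (abs_nonneg _) (abs_nonneg _)]
    exact ENNReal.ofReal_le_ofReal (abs_add_le _ _)
  rcases le_total 1 (ENNReal.ofReal |Y n ω|) with h2 | h2
  · simp only [min_eq_left h2]
    exact (min_le_left _ _).trans le_self_add
  rcases le_total 1 (ENNReal.ofReal |Y' n ω|) with h3 | h3
  · simp only [min_eq_left h3]
    exact (min_le_left _ _).trans le_add_self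
  simp only [min_eq_right h2, min_eq_right h3]
  exact (min_le_right _ _).trans h1

theorem InProbZero.const_mul {μ : Measure Ω} {Y : ℕ → Ω → ℝ} (hY : InProbZero μ Y)
    (hm : ∀ n, Measurable (Y n)) (c : ℝ) : InProbZero μ (fun n ω => c * Y n ω) := by
  have h := ENNReal.Tendsto.const_mul (a := ENNReal.ofReal (1 + |c|)) hY (Or.inr ENNReal.ofReal_ne_top)
  rw [mul_zero] at h
  refine tendsto_of_tendsto_of_tendsto_of_le_of_le tendsto_const_nhds h (fun _ => zero_le)
    fun n => ?_
  simp only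
  rw [← lintegral_const_mul _ (measurable_const.min (hm n).abs.ennreal_ofReal)]
  refine lintegral_mono fun ω => ?_
  have hc1 : (1 : ℝ≥0∞) ≤ ENNReal.ofReal (1 + |c|) := by
    rw [← ENNReal.ofReal_one]; exact ENNReal.ofReal_le_ofReal (by linarith [abs_nonneg c])
  rcases le_total 1 (ENNReal.ofReal |Y n ω|) with h2 | h2
  · simp only [min_eq_left h2, mul_one]
    exact (min_le_left _ _).trans hc1
  · simp only [min_eq_right h2]
    refine (min_le_right _ _).trans ?_
    rw [← ENNReal.ofReal_mul (by positivity), abs_mul]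
    refine ENNReal.ofReal_le_ofReal ?_
    gcongr
    linarith

/-- Convergence in probability to zero and boundedness in `L²` imply convergence of the means. -/
theorem InProbZero.tendsto_integral_abs {μ : Measure Ω} [IsFiniteMeasure μ] {Y : ℕ → Ω → ℝ}
    (hY : InProbZero μ Y) (hm : ∀ n, Measurable (Y n)) (hb : ∀ n, ∃ C, ∀ ω, |Y n ω| ≤ C) {K : ℝ}
    (hK : ∀ᶠ n in atTop, ∫ ω, Y n ω ^ 2 ∂μ ≤ K) :
    Tendsto (fun n => ∫ ω, |Y n ω| ∂μ) atTop (𝓝 0) := by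
  have hmin (n : ℕ) : ∫ ω, min 1 |Y n ω| ∂μ =
      (∫⁻ ω, min 1 (ENNReal.ofReal |Y n ω|) ∂μ).toReal := by
    rw [integral_eq_lintegral_of_nonneg_ae (Eventually.of_forall fun ω => by positivity)
      (measurable_const.min (hm n).abs).aestronglyMeasurable]
    simp only [ENNReal.ofReal_min, ENNReal.ofReal_one]
  have h0 : Tendsto (fun n => ∫ ω, min 1 |Y n ω| ∂μ) atTop (𝓝 0) := by
    simp_rw [hmin]
    exact (ENNReal.tendsto_toReal ENNReal.zero_ne_top).comp hY
  have hint (n : ℕ) : Integrable (Y n) μ := by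
    obtain ⟨C, hC⟩ := hb n
    exact Integrable.of_bound (hm n).aestronglyMeasurable C (Eventually.of_forall hC)
  have hint2 (n : ℕ) : Integrable (fun ω => Y n ω ^ 2) μ := by
    obtain ⟨C, hC⟩ := hb n
    refine Integrable.of_bound ((hm n).pow_const 2).aestronglyMeasurable (C ^ 2)
      (Eventually.of_forall fun ω => ?_)
    rw [norm_pow, Real.norm_eq_abs]
    exact pow_le_pow_left₀ (abs_nonneg _) (hC ω) 2
  have hint3 (n : ℕ) : Integrable (fun ω => min 1 |Y n ω|) μ :=
    (integrable_const 1).inf (hint n).abs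
  -- The first term controls the part where |Y| ≤ M, the second the part where |Y| > M.
  have hle (M : ℝ) (hM : 1 ≤ M) (n : ℕ) :
      ∫ ω, |Y n ω| ∂μ ≤ M * ∫ ω, min 1 |Y n ω| ∂μ + M⁻¹ * ∫ ω, Y n ω ^ 2 ∂μ := by
    rw [← integral_const_mul, ← integral_const_mul,
      ← integral_add ((hint3 n).const_mul M) ((hint2 n).const_mul _)]
    refine integral_mono (hint n).abs (((hint3 n).const_mul M).add ((hint2 n).const_mul _))
      fun ω => ?_
    change |Y n ω| ≤ M * min 1 |Y n ω| + M⁻¹ * Y n ω ^ 2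
    have hM0 : 0 < M := by linarith
    have hy := abs_nonneg (Y n ω)
    rw [← sq_abs]
    rcases le_total |Y n ω| 1 with h1 | h1
    · rw [min_eq_right h1]
      nlinarith [mul_nonneg (sub_nonneg.2 hM) hy, mul_nonneg (inv_nonneg.2 hM0.le) (sq_nonneg |Y n ω|)]
    · rw [min_eq_left h1]
      rcases le_total |Y n ω| M with h2 | h2
      · nlinarith [mul_nonneg (inv_nonneg.2 hM0.le) (sq_nonneg |Y n ω|)]
      · have : |Y n ω| ≤ M⁻¹ * |Y n ω| ^ 2 := by
          rw [inv_mul_eq_div, le_div_iff₀ hM0]; nlinarith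
        linarith
  rw [Metric.tendsto_atTop]
  intro ε hε
  set M : ℝ := max 1 (2 * (|K| + 1) / ε)
  have hM1 : 1 ≤ M := le_max_left _ _
  have hM0 : 0 < M := by linarith
  have hMK : M⁻¹ * K ≤ ε / 2 := by
    have h1 : 2 * (|K| + 1) / ε ≤ M := le_max_right _ _
    rw [div_le_iff₀ hε] at h1
    rw [inv_mul_le_iff₀ hM0]
    have := le_abs_self K
    linarith
  have hev := h0.eventually (gt_mem_nhds (show 0 < ε / (2 * M) by positivity))
  rw [← eventually_atTop]
  filter_upwards [hev, hK] with n h1 h2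
  rw [Real.dist_eq, sub_zero, abs_of_nonneg (integral_nonneg fun ω => abs_nonneg _)]
  calc _ ≤ _ := hle M hM1 n
    _ < M * (ε / (2 * M)) + M⁻¹ * K :=
        add_lt_add_of_lt_of_le (mul_lt_mul_of_pos_left h1 hM0)
          (mul_le_mul_of_nonneg_left h2 (inv_nonneg.2 hM0.le))
    _ = ε / 2 + M⁻¹ * K := by field_simp
    _ ≤ ε := by linarith

end InProbability

/-! ### Change of initial distribution, and truncation to bounded potential. -/

namespace Atom

variable {E : Type*} [MeasurableSpace E] {φ : Measure E} {P : Kernel E E} (a : Atom φ P)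

/-- The restriction of `f` to the set where the first `k` states carry expected `s`-mass at
least one. -/
noncomputable def trunc (f : E → ℝ≥0∞) (k : ℕ) : E → ℝ≥0∞ :=
  {x | 1 ≤ occupation P a.s k x}.indicator f

theorem measurableSet_one_le_occupation (k : ℕ) :
    MeasurableSet {x | 1 ≤ occupation P a.s k x} :=
  measurableSet_le measurable_const (measurable_occupation P a.measurable_s k)

theorem measurable_trunc {f : E → ℝ≥0∞} (hf : Measurable f) (k : ℕ) : Measurable (a.trunc f k) :=
  hf.indicator (a.measurableSet_one_le_occupation k)

theorem trunc_le (f : E → ℝ≥0∞) (k : ℕ) (x : E) : a.trunc f k x ≤ f x :=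
  Set.indicator_le_self _ _ x

variable [IsMarkovKernel P]

/-- Convergence in probability to zero of normalized additive functionals transfers from the
initial distribution `ν` to an arbitrary one. -/
theorem inProbZero_of_nu (hP : IsHarrisRecurrent φ P) {h : ℕ → E → ℝ} (hh : ∀ n, Measurable (h n))
    {C : ℝ} (hC : ∀ n x, |h n x| ≤ C) {b : ℕ → ℝ} (hb : Tendsto b atTop atTop)
    (hν : InProbZero (chainLaw P a.ν)
      (fun n (ω : ℕ → E) => (∑ t ∈ Finset.range n, h n (ω t)) / b n))
    {Ω : Type*} [MeasurableSpace Ω] {Z : ℕ → Ω → E} {μ : Measure Ω} [IsProbabilityMeasure μ]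
    (hZ : IsMarkovChain P Z μ) :
    InProbZero μ (fun n ω => (∑ t ∈ Finset.range n, h n (Z t ω)) / b n) := by
  have := a.isProb
  have : IsProbabilityMeasure (μ.map (Z 0)) :=
    Measure.isProbabilityMeasure_map (hZ.measurable 0).aemeasurable
  set F : ℕ → ℝ → ℝ≥0∞ := fun n y => min 1 (ENNReal.ofReal |y / b n|)
  have hF (n : ℕ) : Measurable (F n) :=
    measurable_const.min (measurable_id.div_const _).abs.ennreal_ofReal
  have hF1 (n : ℕ) (y : ℝ) : F n y ≤ 1 := min_le_left _ _
  set δ : ℕ → ℝ≥0∞ := fun n => ENNReal.ofReal (C / b n)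
  have hδ : Tendsto δ atTop (𝓝 0) := by
    have := ENNReal.tendsto_ofReal (hb.const_div_atTop C)
    simpa using this
  have hFδ : ∀ᶠ n in atTop, ∀ y z, |y - z| ≤ C → F n y ≤ F n z + δ n := by
    filter_upwards [hb.eventually_gt_atTop 0] with n hn y z hyz
    have h1 : |y / b n| ≤ |z / b n| + C / b n := by
      rw [abs_div, abs_div, abs_of_pos hn, ← add_div]
      gcongr
      have := abs_sub_abs_le_abs_sub y z
      linarith
    have hC0 : 0 ≤ C / b n := div_nonneg ((abs_nonneg _).trans hyz) hn.le
    have h2 := ENNReal.ofReal_le_ofReal h1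
    rw [ENNReal.ofReal_add (abs_nonneg _) hC0] at h2
    rcases le_total 1 (ENNReal.ofReal |z / b n|) with h3 | h3
    · simp only [F, min_eq_left h3]
      exact (min_le_left _ _).trans le_self_add
    · simp only [F, min_eq_right h3]
      exact (min_le_right _ _).trans h2
  set p : ℕ → E → ℝ≥0∞ := fun n => sumLaw P (h n) (F n) n 0
  have hp (n : ℕ) : Measurable (p n) :=
    (measurable_sumLaw (hh n) (hF n) n).comp measurable_prodMk_left
  have hpν (n : ℕ) : ∫⁻ ω : ℕ → E, F n (∑ t ∈ Finset.range n, h n (ω t)) ∂chainLaw P a.ν =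
      ∫⁻ x, p n x ∂a.ν := by
    rw [(isMarkovChain_chainLaw P a.ν).lintegral_sumLaw (hh n) (hF n) n, map_chainLaw_zero]
  have hpμ (n : ℕ) : ∫⁻ ω, F n (∑ t ∈ Finset.range n, h n (Z t ω)) ∂μ =
      ∫⁻ x, p n x ∂μ.map (Z 0) := hZ.lintegral_sumLaw (hh n) (hF n) n
  have hν' : Tendsto (fun n => ∫⁻ x, p n x ∂a.ν) atTop (𝓝 0) := by
    simp_rw [← hpν]; exact hν
  change Tendsto (fun n => ∫⁻ ω, F n (∑ t ∈ Finset.range n, h n (Z t ω)) ∂μ) atTop (𝓝 0)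
  simp_rw [hpμ]
  -- Iterating the almost subharmonic inequality for k steps costs 2kδ_n. The mass that has
  -- regenerated by then is governed by ν, and the rest is the taboo mass. Here k is fixed before n
  -- tends to infinity.
  have hle (k : ℕ) : ∀ᶠ n in atTop, ∫⁻ x, p n x ∂μ.map (Z 0) ≤
      (k * (2 * δ n) + ∫⁻ x, p n x ∂a.ν) +
        ∫⁻ x, (a.taboo ^ k) x Set.univ ∂μ.map (Z 0) := by
    filter_upwards [hFδ] with n hn
    calc _ ≤ ∫⁻ x, (k * (2 * δ n) + (a.taboo ^ k) x Set.univ + ∫⁻ y, p n y ∂a.ν) ∂μ.map (Z 0) :=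
          lintegral_mono fun x => a.le_of_le_lintegral (hp n) (sumLaw_le_one (hF1 n) n 0)
            (sumLaw_le_lintegral hn (hC n) n) k x
      _ = _ := by
          rw [lintegral_add_right _ measurable_const, lintegral_add_left measurable_const]
          simp only [lintegral_const, measure_univ, mul_one]
          ring
  rw [ENNReal.tendsto_nhds_zero]
  intro ε hε
  have hε2 : 0 < ε / 2 := ENNReal.half_pos hε.ne'
  obtain ⟨k, hk⟩ :=
    ((ENNReal.tendsto_nhds_zero.1 (a.tendsto_taboo_pow hP (μ.map (Z 0)))) _ hε2).exists
  have hlim : Tendsto (fun n => k * (2 * δ n) + ∫⁻ x, p n x ∂a.ν) atTop (𝓝 0) := by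
    have h1 := ENNReal.Tendsto.const_mul (a := (k : ℝ≥0∞))
      (ENNReal.Tendsto.const_mul (a := 2) hδ (Or.inr (by simp))) (Or.inr (by simp))
    simpa using h1.add hν'
  filter_upwards [hle k, ENNReal.tendsto_nhds_zero.1 hlim _ hε2] with n h1 h2
  calc _ ≤ _ := h1
    _ ≤ ε / 2 + ε / 2 := add_le_add h2 hk
    _ = ε := ENNReal.add_halves ε

/-- On the truncation set f ≤ 1 ≤ U_k s, and the potential of U_k s is at most k². -/
theorem green_trunc_le {f : E → ℝ≥0∞} (hf1 : ∀ x, f x ≤ 1) (k : ℕ) (x : E) :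
    ∫⁻ y, a.trunc f k y ∂a.green x ≤ (k : ℝ≥0∞) * k := by
  refine (lintegral_mono fun y => ?_).trans (a.green_occupation_le k x)
  refine Set.indicator_apply_le' (fun hy => ?_) fun _ => zero_le
  exact (hf1 y).trans hy

theorem lintegral_invMeasure_trunc_ne_top {f : E → ℝ≥0∞} (hf : Measurable f) (hf1 : ∀ x, f x ≤ 1)
    (k : ℕ) : ∫⁻ y, a.trunc f k y ∂a.invMeasure ≠ ∞ :=
  ne_top_of_le_ne_top (by finiteness)
    (a.lintegral_invMeasure_le (a.measurable_trunc hf k) (a.green_trunc_le hf1 k))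

/-- By Harris recurrence U_k s increases to infinity at every point, so the truncation sets exhaust
the space. -/
theorem tendsto_lintegral_trunc (hP : IsHarrisRecurrent φ P) {f : E → ℝ≥0∞} (hf : Measurable f)
    (m : Measure E) : Tendsto (fun k => ∫⁻ y, a.trunc f k y ∂m) atTop (𝓝 (∫⁻ y, f y ∂m)) := by
  refine lintegral_tendsto_of_tendsto_of_monotone
    (fun k => (a.measurable_trunc hf k).aemeasurable)
    (Eventually.of_forall fun x k l hkl => ?_) (Eventually.of_forall fun x => ?_)
  · exact Set.indicator_le_indicator_of_subset
      (fun y hy => le_trans hy (occupation_mono P a.s y hkl)) (fun _ => zero_le) x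
  · refine tendsto_const_nhds.congr' ?_
    have h := tendsto_atTop_iSup (occupation_mono P a.s x)
    rw [hP.iSup_occupation a.isPosFun] at h
    filter_upwards [h.eventually (lt_mem_nhds ENNReal.one_lt_top)] with k hk
    exact (Set.indicator_of_mem (s := {x | 1 ≤ occupation P a.s k x}) hk.le f).symm

end Atom

/-! ### Moments of sums of bounded functions along the chain. -/

section BoundedFunctions

theorem abs_sum_comp_le {α β : Type*} {Z : ℕ → α → β} {h : β → ℝ} {C : ℝ} (hC : ∀ x, |h x| ≤ C) (n : ℕ) (ω : α) :
    |∑ t ∈ Finset.range n, h (Z t ω)| ≤ n * C := by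
  calc _ ≤ ∑ t ∈ Finset.range n, |h (Z t ω)| := Finset.abs_sum_le_sum_abs _ _
    _ ≤ ∑ t ∈ Finset.range n, C := Finset.sum_le_sum fun t _ => hC _
    _ = n * C := by simp

variable {E : Type*} [MeasurableSpace E] {P : Kernel E E} [IsMarkovKernel P]
  {Ω : Type*} [MeasurableSpace Ω] {Z : ℕ → Ω → E} {μ : Measure Ω} [IsProbabilityMeasure μ]

theorem toReal_mem_Icc {r : ℝ≥0∞} (h : r ≤ 1) : r.toReal ∈ Set.Icc (0 : ℝ) 1 :=
  ⟨ENNReal.toReal_nonneg, by simpa using ENNReal.toReal_mono ENNReal.one_ne_top h⟩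

theorem integral_toReal_of_le_one {α : Type*} [MeasurableSpace α] {m : Measure α} {f : α → ℝ≥0∞}
    (hf : Measurable f) (hf1 : ∀ x, f x ≤ 1) : ∫ x, (f x).toReal ∂m = (∫⁻ x, f x ∂m).toReal :=
  integral_toReal hf.aemeasurable
    (Eventually.of_forall fun x => (hf1 x).trans_lt ENNReal.one_lt_top)

theorem sum_integral_pow {f : E → ℝ≥0∞} (hf : Measurable f) (hf1 : ∀ x, f x ≤ 1) (n : ℕ) (x : E) :
    ∑ l ∈ Finset.range n, ∫ y, (f y).toReal ∂(P ^ l) x = (occupation P f n x).toReal := by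
  unfold occupation
  rw [ENNReal.toReal_sum]
  · exact Finset.sum_congr rfl fun l _ => integral_toReal_of_le_one hf hf1
  · intro l _
    refine ne_top_of_le_ne_top ENNReal.one_ne_top ?_
    calc ∫⁻ y, f y ∂(P ^ l) x ≤ ∫⁻ _, 1 ∂(P ^ l) x := lintegral_mono hf1
      _ = 1 := by simp

theorem measurable_sum_comp (hZ : ∀ t, Measurable (Z t)) {h : E → ℝ} (hh : Measurable h) (n : ℕ) :
    Measurable fun ω => ∑ t ∈ Finset.range n, h (Z t ω) :=
  Finset.measurable_fun_sum _ fun t _ => hh.comp (hZ t)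

theorem integrable_sum_comp (hZ : ∀ t, Measurable (Z t)) {h : E → ℝ} (hh : Measurable h) {C : ℝ}
    (hC : ∀ x, |h x| ≤ C) (n : ℕ) : Integrable (fun ω => ∑ t ∈ Finset.range n, h (Z t ω)) μ :=
  Integrable.of_bound (measurable_sum_comp hZ hh n).aestronglyMeasurable (n * C)
    (Eventually.of_forall fun ω => abs_sum_comp_le hC n ω)

theorem IsMarkovChain.integral_sum_toReal (hZ : IsMarkovChain P Z μ) {f : E → ℝ≥0∞}
    (hf : Measurable f) (hf1 : ∀ x, f x ≤ 1) (n : ℕ) :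
    ∫ ω, ∑ t ∈ Finset.range n, (f (Z t ω)).toReal ∂μ =
      (∫⁻ x, occupation P f n x ∂μ.map (Z 0)).toReal := by
  have hft (t : ℕ) : Measurable fun ω => f (Z t ω) := hf.comp (hZ.measurable t)
  rw [← hZ.lintegral_sum_eq n hf, ← integral_toReal]
  · refine integral_congr_ae (Eventually.of_forall fun ω => ?_)
    exact (ENNReal.toReal_sum fun t _ => ((hf1 _).trans_lt ENNReal.one_lt_top).ne).symm
  · exact (Finset.measurable_fun_sum _ fun t _ => hft t).aemeasurable
  · refine Eventually.of_forall fun ω => ENNReal.sum_lt_top.2 fun t _ => ?_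
    exact (hf1 _).trans_lt ENNReal.one_lt_top

end BoundedFunctions

namespace Atom

variable {E : Type*} [MeasurableSpace E] {φ : Measure E} {P : Kernel E E} (a : Atom φ P)

theorem measurable_toReal_s : Measurable fun x => (a.s x).toReal := a.measurable_s.ennreal_toReal

/-- The centred function `f - c s`. -/
noncomputable def centred (f : E → ℝ≥0∞) (c : ℝ) (x : E) : ℝ := (f x).toReal - c * (a.s x).toReal

theorem measurable_centred {f : E → ℝ≥0∞} (hf : Measurable f) (c : ℝ) :
    Measurable (a.centred f c) :=
  hf.ennreal_toReal.sub (a.measurable_toReal_s.const_mul c)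

theorem abs_centred_le_add {f : E → ℝ≥0∞} {c : ℝ} (hc : 0 ≤ c) (x : E) :
    |a.centred f c x| ≤ (f x).toReal + c * (a.s x).toReal := by
  have h1 : 0 ≤ (f x).toReal := ENNReal.toReal_nonneg
  have h2 : 0 ≤ c * (a.s x).toReal := mul_nonneg hc ENNReal.toReal_nonneg
  unfold centred
  rw [abs_le]; constructor <;> linarith

variable [IsMarkovKernel P] {Ω : Type*} [MeasurableSpace Ω] {Z : ℕ → Ω → E} {μ : Measure Ω}
  [IsProbabilityMeasure μ]

theorem toReal_renewal_add_one (n : ℕ) : (1 + a.renewal n).toReal = 1 + (a.renewal n).toReal := by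
  rw [ENNReal.toReal_add ENNReal.one_ne_top (a.renewal_ne_top n), ENNReal.toReal_one]

theorem abs_toReal_s_le (x : E) : |(a.s x).toReal| ≤ 1 := by
  have h := toReal_mem_Icc (a.s_le_one x)
  rw [abs_of_nonneg h.1]; exact h.2

theorem toReal_lintegral_occupation_le (lam : Measure E) [IsProbabilityMeasure lam] (n : ℕ) :
    (∫⁻ x, occupation P a.s n x ∂lam).toReal ≤ 1 + (a.renewal n).toReal := by
  rw [← a.toReal_renewal_add_one]
  exact ENNReal.toReal_mono (by simp [a.renewal_ne_top]) (a.lintegral_occupation_le_renewal lam n)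

/-- Both the expected future sum from any state and the mean of the whole sum are at most 1 + A(n).
The resulting L² bound is what lets limits in probability pass to means. -/
theorem integral_sum_s_sq_le (hZ : IsMarkovChain P Z μ) (n : ℕ) :
    ∫ ω, (∑ t ∈ Finset.range n, (a.s (Z t ω)).toReal) ^ 2 ∂μ ≤
      2 * (1 + (a.renewal n).toReal) ^ 2 := by
  have : IsProbabilityMeasure (μ.map (Z 0)) :=
    Measure.isProbabilityMeasure_map (hZ.measurable 0).aemeasurable
  have h := hZ.integral_sum_sq_le a.measurable_toReal_s a.abs_toReal_s_le
    (K := 1 + (a.renewal n).toReal) n (fun m hm x => by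
      rw [sum_integral_pow a.measurable_s a.s_le_one, abs_of_nonneg ENNReal.toReal_nonneg,
        ← a.toReal_renewal_add_one]
      exact ENNReal.toReal_mono (by simp [a.renewal_ne_top])
        ((occupation_mono P a.s x hm).trans (a.occupation_le_renewal n x)))
  refine h.trans ?_
  have h2 : ∑ t ∈ Finset.range n, ∫ ω, |(a.s (Z t ω)).toReal| ∂μ =
      (∫⁻ x, occupation P a.s n x ∂μ.map (Z 0)).toReal := by
    rw [← hZ.integral_sum_toReal a.measurable_s a.s_le_one, integral_finsetSum]
    · simp_rw [abs_of_nonneg ENNReal.toReal_nonneg]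
    · intro t _
      exact Integrable.of_bound
        (a.measurable_toReal_s.comp (hZ.measurable t)).aestronglyMeasurable 1
        (Eventually.of_forall fun ω => a.abs_toReal_s_le _)
  rw [h2]
  have h3 := a.toReal_lintegral_occupation_le (μ.map (Z 0)) n
  have h4 : 0 ≤ (a.renewal n).toReal := ENNReal.toReal_nonneg
  nlinarith

theorem abs_centred_le {f : E → ℝ≥0∞} (hf1 : ∀ x, f x ≤ 1) {c : ℝ} (hc : 0 ≤ c) (x : E) :
    |a.centred f c x| ≤ 1 + c := by
  refine (a.abs_centred_le_add hc x).trans ?_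
  have h2 := mul_le_mul_of_nonneg_left (toReal_mem_Icc (a.s_le_one x)).2 hc
  linarith [(toReal_mem_Icc (hf1 x)).2]

/-- Second moment of the centred additive functional of a function with bounded potential. -/
theorem integral_sum_centred_sq_le (hZ : IsMarkovChain P Z μ) {f : E → ℝ≥0∞} (hf : Measurable f)
    (hf1 : ∀ x, f x ≤ 1) {K : ℝ≥0∞} (hK : K ≠ ∞) (hG : ∀ x, ∫⁻ y, f y ∂a.green x ≤ K) (n : ℕ) :
    ∫ ω, (∑ t ∈ Finset.range n,
      a.centred f (∫⁻ y, f y ∂a.invMeasure).toReal (Z t ω)) ^ 2 ∂μ ≤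
      2 * K.toReal * (K.toReal + 2 * (∫⁻ y, f y ∂a.invMeasure).toReal *
        (1 + (a.renewal n).toReal)) := by
  have : IsProbabilityMeasure (μ.map (Z 0)) :=
    Measure.isProbabilityMeasure_map (hZ.measurable 0).aemeasurable
  have habs := a.abs_lintegral_occupation_sub_le hf hK hG
  set c := (∫⁻ y, f y ∂a.invMeasure).toReal
  have hc : 0 ≤ c := ENNReal.toReal_nonneg
  have hint {g : E → ℝ≥0∞} (hg : Measurable g) (hg1 : ∀ x, g x ≤ 1) (m : Measure E)
      [IsProbabilityMeasure m] : Integrable (fun y => (g y).toReal) m :=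
    Integrable.of_bound hg.ennreal_toReal.aestronglyMeasurable 1
      (Eventually.of_forall fun y => by
        rw [Real.norm_eq_abs, abs_of_nonneg ENNReal.toReal_nonneg]; exact (toReal_mem_Icc (hg1 y)).2)
  -- Applied to point masses, the iterated Poisson equation bounds the centred expectations by K at
  -- every horizon. The second moment is therefore linear, not quadratic, in the renewal function.
  have h := hZ.integral_sum_sq_le (a.measurable_centred hf c) (a.abs_centred_le hf1 hc)
    (K := K.toReal) n (fun m _ x => by
      have hx := habs (Measure.dirac x) m
      rw [lintegral_dirac' _ (measurable_occupation P hf m),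
        lintegral_dirac' _ (measurable_occupation P a.measurable_s m)] at hx
      have hsum : ∑ l ∈ Finset.range m, ∫ y, a.centred f c y ∂(P ^ l) x =
          (occupation P f m x).toReal - c * (occupation P a.s m x).toReal := by
        rw [← sum_integral_pow hf hf1, ← sum_integral_pow a.measurable_s a.s_le_one,
          Finset.mul_sum, ← Finset.sum_sub_distrib]
        refine Finset.sum_congr rfl fun l _ => ?_
        unfold centred
        rw [integral_sub (hint hf hf1 _) ((hint a.measurable_s a.s_le_one _).const_mul c),
          integral_const_mul]
      rw [hsum]
      exact hx)
  refine h.trans ?_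
  have hintZ {g : E → ℝ≥0∞} (hg : Measurable g) (hg1 : ∀ x, g x ≤ 1) (t : ℕ) :
      Integrable (fun ω => (g (Z t ω)).toReal) μ :=
    Integrable.of_bound (hg.ennreal_toReal.comp (hZ.measurable t)).aestronglyMeasurable 1
      (Eventually.of_forall fun ω => by
        change ‖(g (Z t ω)).toReal‖ ≤ 1
        rw [Real.norm_eq_abs, abs_of_nonneg ENNReal.toReal_nonneg]
        exact (toReal_mem_Icc (hg1 _)).2)
  have h2 : ∑ t ∈ Finset.range n, ∫ ω, |a.centred f c (Z t ω)| ∂μ ≤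
      (∫⁻ x, occupation P f n x ∂μ.map (Z 0)).toReal +
        c * (∫⁻ x, occupation P a.s n x ∂μ.map (Z 0)).toReal := by
    rw [← hZ.integral_sum_toReal a.measurable_s a.s_le_one, ← hZ.integral_sum_toReal hf hf1,
      integral_finsetSum _ fun t _ => hintZ hf hf1 t,
      integral_finsetSum _ fun t _ => hintZ a.measurable_s a.s_le_one t, Finset.mul_sum,
      ← Finset.sum_add_distrib]
    refine Finset.sum_le_sum fun t _ => ?_
    rw [← integral_const_mul, ← integral_add (hintZ hf hf1 t)
      ((hintZ a.measurable_s a.s_le_one t).const_mul c)]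
    refine integral_mono ?_ ((hintZ hf hf1 t).add ((hintZ a.measurable_s a.s_le_one t).const_mul c))
      fun ω => a.abs_centred_le_add hc _
    exact ((hintZ hf hf1 t).sub ((hintZ a.measurable_s a.s_le_one t).const_mul c)).abs
  have h3 := mul_le_mul_of_nonneg_left (a.toReal_lintegral_occupation_le (μ.map (Z 0)) n) hc
  have h4 := (abs_le.1 (habs (μ.map (Z 0)) n)).2
  have hK0 : 0 ≤ 2 * K.toReal := by positivity
  refine mul_le_mul_of_nonneg_left (h2.trans ?_) hK0
  linarith

end Atom

/-! ### The ratio limit theorem in probability. -/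

namespace Atom

variable {E : Type*} [MeasurableSpace E] {φ : Measure E} {P : Kernel E E} [IsMarkovKernel P]
  (a : Atom φ P) {Ω : Type*} [MeasurableSpace Ω] {Z : ℕ → Ω → E} {μ : Measure Ω}
  [IsProbabilityMeasure μ]

theorem toReal_renewal (hZ : IsMarkovChain P Z μ) (hZ0 : μ.map (Z 0) = a.ν) (n : ℕ) :
    ∫ ω, ∑ t ∈ Finset.range n, (a.s (Z t ω)).toReal ∂μ = (a.renewal n).toReal := by
  rw [hZ.integral_sum_toReal a.measurable_s a.s_le_one, hZ0, renewal]

theorem integral_sum_nu_le (hZ : IsMarkovChain P Z μ) (hZ0 : μ.map (Z 0) = a.ν) {f : E → ℝ≥0∞}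
    (hf : Measurable f) (hf1 : ∀ x, f x ≤ 1) (hfin : ∫⁻ y, f y ∂a.invMeasure ≠ ∞) (n : ℕ) :
    ∫ ω, ∑ t ∈ Finset.range n, (f (Z t ω)).toReal ∂μ ≤
      (∫⁻ y, f y ∂a.invMeasure).toReal * (1 + (a.renewal n).toReal) := by
  have := a.renewal_ne_top n
  rw [hZ.integral_sum_toReal hf hf1, hZ0, ← a.toReal_renewal_add_one, ← ENNReal.toReal_mul]
  exact ENNReal.toReal_mono (by finiteness) (a.lintegral_nu_occupation_le hf n)

/-- With f = g + e, g the truncation and d = π(e), the centred sum of f is that of g, plus the sum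
of e, minus d times the sum of s. The first is estimated in L² through |y| ≤ τ + y²/τ, and the other
two by their means under the initial law ν. -/
theorem integral_abs_sum_centred_le (hZ : IsMarkovChain P Z μ) (hZ0 : μ.map (Z 0) = a.ν)
    {f : E → ℝ≥0∞} (hf : Measurable f) (hf1 : ∀ x, f x ≤ 1)
    (hfin : ∫⁻ y, f y ∂a.invMeasure ≠ ∞) (k n : ℕ) {τ : ℝ} (hτ : 0 < τ) :
    ∫ ω, |∑ t ∈ Finset.range n, a.centred f (∫⁻ y, f y ∂a.invMeasure).toReal (Z t ω)| ∂μ ≤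
      ((∫⁻ y, f y ∂a.invMeasure).toReal - (∫⁻ y, a.trunc f k y ∂a.invMeasure).toReal) *
        (1 + 2 * (a.renewal n).toReal) + τ +
      τ⁻¹ * (2 * (k * k : ℝ) * ((k * k : ℝ) +
        2 * (∫⁻ y, a.trunc f k y ∂a.invMeasure).toReal * (1 + (a.renewal n).toReal))) := by
  set g := a.trunc f k
  set e : E → ℝ≥0∞ := {x | 1 ≤ occupation P a.s k x}ᶜ.indicator f
  have hg : Measurable g := a.measurable_trunc hf k
  have hg1 (x : E) : g x ≤ 1 := (a.trunc_le f k x).trans (hf1 x)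
  have he : Measurable e := hf.indicator (a.measurableSet_one_le_occupation k).compl
  have he1 (x : E) : e x ≤ 1 := (Set.indicator_le_self _ _ x).trans (hf1 x)
  have hsum (x : E) : f x = g x + e x :=
    (congrFun (Set.indicator_self_add_compl {x | 1 ≤ occupation P a.s k x} f) x).symm
  have hπ : ∫⁻ y, f y ∂a.invMeasure = ∫⁻ y, g y ∂a.invMeasure + ∫⁻ y, e y ∂a.invMeasure := by
    rw [← lintegral_add_left hg]
    exact lintegral_congr hsum
  have hgfin : ∫⁻ y, g y ∂a.invMeasure ≠ ∞ := ne_top_of_le_ne_top hfin (hπ ▸ le_self_add)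
  have hefin : ∫⁻ y, e y ∂a.invMeasure ≠ ∞ := ne_top_of_le_ne_top hfin (hπ ▸ le_add_self)
  have hπ' := congrArg ENNReal.toReal hπ
  rw [ENNReal.toReal_add hgfin hefin] at hπ'
  have hKfin : (k : ℝ≥0∞) * k ≠ ∞ := by finiteness
  have hsq := a.integral_sum_centred_sq_le hZ hg hg1 hKfin (a.green_trunc_le hf1 k) n
  have hE := a.integral_sum_nu_le hZ hZ0 he he1 hefin n
  have hU := a.toReal_renewal hZ hZ0 n
  rw [hπ']
  set c := (∫⁻ y, g y ∂a.invMeasure).toReal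
  set d := (∫⁻ y, e y ∂a.invMeasure).toReal
  have hc : 0 ≤ c := ENNReal.toReal_nonneg
  have hd : 0 ≤ d := ENNReal.toReal_nonneg
  have hKr : ((k : ℝ≥0∞) * k).toReal = (k : ℝ) * k := by simp
  rw [hKr] at hsq
  have hpt (x : E) : a.centred f (c + d) x = (e x).toReal + a.centred g c x - d * (a.s x).toReal := by
    unfold centred
    rw [hsum x, ENNReal.toReal_add ((hg1 x).trans_lt ENNReal.one_lt_top).ne
      ((he1 x).trans_lt ENNReal.one_lt_top).ne]
    ring
  have hmZ := hZ.measurable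
  have hie : Integrable (fun ω => ∑ t ∈ Finset.range n, (e (Z t ω)).toReal) μ :=
    integrable_sum_comp hmZ (h := fun x => (e x).toReal) he.ennreal_toReal (C := 1) (fun x => by
      rw [abs_of_nonneg ENNReal.toReal_nonneg]; exact (toReal_mem_Icc (he1 x)).2) n
  have his : Integrable (fun ω => ∑ t ∈ Finset.range n, (a.s (Z t ω)).toReal) μ :=
    integrable_sum_comp hmZ a.measurable_toReal_s a.abs_toReal_s_le n
  have higsq : Integrable (fun ω => (∑ t ∈ Finset.range n, a.centred g c (Z t ω)) ^ 2) μ := by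
    refine Integrable.of_bound
      ((measurable_sum_comp hmZ (a.measurable_centred hg c) n).pow_const 2).aestronglyMeasurable
      ((n * (1 + c)) ^ 2) (Eventually.of_forall fun ω => ?_)
    rw [norm_pow, Real.norm_eq_abs]
    exact pow_le_pow_left₀ (abs_nonneg _) (abs_sum_comp_le (a.abs_centred_le hg1 hc) n ω) 2
  have hi1 : Integrable (fun ω => τ + τ⁻¹ *
      (∑ t ∈ Finset.range n, a.centred g c (Z t ω)) ^ 2) μ :=
    (integrable_const τ).add (higsq.const_mul _)
  have hi2 : Integrable (fun ω => (∑ t ∈ Finset.range n, (e (Z t ω)).toReal) + (τ + τ⁻¹ *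
      (∑ t ∈ Finset.range n, a.centred g c (Z t ω)) ^ 2)) μ := hie.add hi1
  calc ∫ ω, |∑ t ∈ Finset.range n, a.centred f (c + d) (Z t ω)| ∂μ
      ≤ ∫ ω, (((∑ t ∈ Finset.range n, (e (Z t ω)).toReal) + (τ + τ⁻¹ *
          (∑ t ∈ Finset.range n, a.centred g c (Z t ω)) ^ 2)) +
          d * ∑ t ∈ Finset.range n, (a.s (Z t ω)).toReal) ∂μ := by
        refine integral_mono_of_nonneg (Eventually.of_forall fun ω => abs_nonneg _)
          (hi2.add (his.const_mul d))
          (Eventually.of_forall fun ω => ?_)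
        have h1 : ∑ t ∈ Finset.range n, a.centred f (c + d) (Z t ω) =
            ∑ t ∈ Finset.range n, (e (Z t ω)).toReal +
            ∑ t ∈ Finset.range n, a.centred g c (Z t ω) -
            d * ∑ t ∈ Finset.range n, (a.s (Z t ω)).toReal := by
          simp_rw [hpt]
          rw [Finset.sum_sub_distrib, Finset.sum_add_distrib, Finset.mul_sum]
        have h2 : 0 ≤ ∑ t ∈ Finset.range n, (e (Z t ω)).toReal :=
          Finset.sum_nonneg fun t _ => ENNReal.toReal_nonneg
        have h3 : 0 ≤ d * ∑ t ∈ Finset.range n, (a.s (Z t ω)).toReal :=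
          mul_nonneg hd (Finset.sum_nonneg fun t _ => ENNReal.toReal_nonneg)
        set y := ∑ t ∈ Finset.range n, a.centred g c (Z t ω)
        have h4 : |y| ≤ τ + τ⁻¹ * y ^ 2 := by
          rw [← sub_le_iff_le_add', inv_mul_eq_div, le_div_iff₀ hτ, ← sq_abs]
          nlinarith [sq_nonneg (|y| - τ), abs_nonneg y, mul_nonneg (abs_nonneg y) hτ.le]
        have h5 := abs_le.1 (le_refl |y|)
        simp only [h1]
        rw [abs_le]
        constructor <;> linarith
    _ = ∫ ω, ∑ t ∈ Finset.range n, (e (Z t ω)).toReal ∂μ + (τ + τ⁻¹ *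
          ∫ ω, (∑ t ∈ Finset.range n, a.centred g c (Z t ω)) ^ 2 ∂μ) +
          d * (a.renewal n).toReal := by
        rw [integral_add hi2 (his.const_mul d), integral_add hie hi1,
          integral_add (integrable_const τ) (higsq.const_mul _), integral_const_mul,
          integral_const_mul, hU]
        simp
    _ ≤ d * (1 + (a.renewal n).toReal) + (τ + τ⁻¹ * (2 * (k * k : ℝ) * ((k * k : ℝ) +
          2 * c * (1 + (a.renewal n).toReal)))) + d * (a.renewal n).toReal := by
        gcongr
    _ = _ := by ring

theorem tendsto_integral_abs_sum_centred (hP : IsHarrisRecurrent φ P) (hZ : IsMarkovChain P Z μ)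
    (hZ0 : μ.map (Z 0) = a.ν) {f : E → ℝ≥0∞} (hf : Measurable f) (hf1 : ∀ x, f x ≤ 1)
    (hfin : ∫⁻ y, f y ∂a.invMeasure ≠ ∞) :
    Tendsto (fun n => (∫ ω, |∑ t ∈ Finset.range n,
      a.centred f (∫⁻ y, f y ∂a.invMeasure).toReal (Z t ω)| ∂μ) / (a.renewal n).toReal)
      atTop (𝓝 0) := by
  have hle := a.integral_abs_sum_centred_le hZ hZ0 hf hf1 hfin
  have hlim := (ENNReal.tendsto_toReal hfin).comp
    (a.tendsto_lintegral_trunc hP hf a.invMeasure)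
  set c := (∫⁻ y, f y ∂a.invMeasure).toReal
  rw [Metric.tendsto_atTop]
  intro ε hε
  rw [← eventually_atTop]
  -- The remainder enters with factor 1 + 2A ≤ 3A, so mass ε/12 contributes εA/4. The two terms
  -- governed by δ = ε/4 bring the total to at most 3εA/4.
  obtain ⟨k, hk⟩ := (hlim.eventually (lt_mem_nhds (show c - ε / 12 < c by linarith))).exists
  set ck := (∫⁻ y, a.trunc f k y ∂a.invMeasure).toReal
  have hck : c - ε / 12 < ck := hk
  have hckc : ck ≤ c := ENNReal.toReal_mono hfin (lintegral_mono fun x => a.trunc_le f k x)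
  have hck0 : 0 ≤ ck := ENNReal.toReal_nonneg
  set K : ℝ := k * k
  have hK0 : 0 ≤ K := by positivity
  set δ := ε / 4
  have hδ : 0 < δ := by positivity
  have hA := a.tendsto_renewal hP
  filter_upwards [hA.eventually_ge_atTop 1,
    hA.eventually_ge_atTop (2 * K * (K + 4 * ck) / (δ * δ))] with n h1 h2
  set A := (a.renewal n).toReal
  have hA0 : 0 < A := by linarith
  -- With τ of order A, the second moment O(A) divided by τ stays bounded, hence falls below δA for
  -- large n.
  have hmain := hle k n (τ := δ * A) (by positivity)
  rw [Real.dist_eq, sub_zero,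
    abs_of_nonneg (div_nonneg (integral_nonneg fun ω => abs_nonneg _) hA0.le), div_lt_iff₀ hA0]
  rw [div_le_iff₀ (by positivity)] at h2
  have h3 : (δ * A)⁻¹ * (2 * K * (K + 2 * ck * (1 + A))) ≤ δ * A := by
    rw [inv_mul_le_iff₀ (by positivity)]
    have h4 : K + 2 * ck * (1 + A) ≤ (K + 4 * ck) * A := by nlinarith
    calc 2 * K * (K + 2 * ck * (1 + A)) ≤ 2 * K * ((K + 4 * ck) * A) := by gcongr
      _ = (2 * K * (K + 4 * ck)) * A := by ring
      _ ≤ (A * (δ * δ)) * A := by gcongr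
      _ = _ := by ring
  have h5 : (c - ck) * (1 + 2 * A) ≤ ε / 12 * (3 * A) := by
    apply mul_le_mul <;> linarith
  have h6 : δ * A = ε / 4 * A := rfl
  have h7 : 0 < ε * A := by positivity
  linarith

/-- The ratio limit theorem in probability, for an arbitrary initial distribution. -/
theorem inProbZero_centred (hP : IsHarrisRecurrent φ P) (hZ : IsMarkovChain P Z μ)
    {f : E → ℝ≥0∞} (hf : Measurable f) (hf1 : ∀ x, f x ≤ 1)
    (hfin : ∫⁻ y, f y ∂a.invMeasure ≠ ∞) {b : ℕ → ℝ} (hb : ∀ n, (a.renewal n).toReal ≤ b n) :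
    InProbZero μ (fun n ω => (∑ t ∈ Finset.range n,
      a.centred f (∫⁻ y, f y ∂a.invMeasure).toReal (Z t ω)) / b n) := by
  have := a.isProb
  have hν := isMarkovChain_chainLaw P a.ν
  have hL1 := a.tendsto_integral_abs_sum_centred hP hν (map_chainLaw_zero P a.ν) hf hf1 hfin
  set c := (∫⁻ y, f y ∂a.invMeasure).toReal
  have hc : 0 ≤ c := ENNReal.toReal_nonneg
  have h := a.inProbZero_of_nu hP (h := fun _ => a.centred f c)
    (fun _ => a.measurable_centred hf c) (fun _ => a.abs_centred_le hf1 hc)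
    (a.tendsto_renewal hP) (InProbZero.of_integral_abs (fun n =>
      (integrable_sum_comp hν.measurable (a.measurable_centred hf c) (a.abs_centred_le hf1 hc)
        n).div_const _) (hL1.congr fun n => ?_)) hZ
  · refine h.mono ?_
    filter_upwards [(a.tendsto_renewal hP).eventually_gt_atTop 0] with n hn ω
    rw [abs_div, abs_div, abs_of_pos hn, abs_of_pos (hn.trans_le (hb n))]
    exact div_le_div_of_nonneg_left (abs_nonneg _) hn (hb n)
  · simp_rw [abs_div, abs_of_nonneg (ENNReal.toReal_nonneg (a := a.renewal n))]
    rw [integral_div]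

/-- Under ν the expected sum is exactly zero, so the normalization may be any sequence tending to
infinity, unrelated to the renewal function of this chain. -/
theorem inProbZero_of_invMeasure_eq_zero (hP : IsHarrisRecurrent φ P) (hZ : IsMarkovChain P Z μ)
    {f : E → ℝ≥0∞} (hf : Measurable f) (hf1 : ∀ x, f x ≤ 1)
    (hzero : ∫⁻ y, f y ∂a.invMeasure = 0) {b : ℕ → ℝ} (hb : Tendsto b atTop atTop) :
    InProbZero μ (fun n ω => (∑ t ∈ Finset.range n, (f (Z t ω)).toReal) / b n) := by
  have := a.isProb
  have hν := isMarkovChain_chainLaw P a.ν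
  have hC (x : E) : |(f x).toReal| ≤ 1 := by
    rw [abs_of_nonneg ENNReal.toReal_nonneg]; exact (toReal_mem_Icc (hf1 x)).2
  refine a.inProbZero_of_nu hP (h := fun _ x => (f x).toReal) (fun _ => hf.ennreal_toReal)
    (fun _ => hC) hb (InProbZero.of_integral_abs (fun n =>
      (integrable_sum_comp hν.measurable hf.ennreal_toReal hC n).div_const _) ?_) hZ
  refine tendsto_const_nhds.congr fun n => ?_
  have h1 := a.integral_sum_nu_le hν (map_chainLaw_zero P a.ν) hf hf1 (by simp [hzero]) n
  rw [hzero, ENNReal.toReal_zero, zero_mul] at h1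
  have h2 (ω : ℕ → E) : 0 ≤ ∑ t ∈ Finset.range n, (f (ω t)).toReal :=
    Finset.sum_nonneg fun t _ => ENNReal.toReal_nonneg
  simp_rw [abs_div, abs_of_nonneg (h2 _)]
  rw [integral_div, le_antisymm h1 (integral_nonneg h2), zero_div]

end Atom

/-! ### From comparison in probability to comparison of means. -/

section Comparison

variable {Ω : Type*} [MeasurableSpace Ω] {μ : Measure Ω} [IsProbabilityMeasure μ]

/-- Comparison of means along `L²`-bounded sequences, from a comparison in probability. -/
theorem eventually_mean_le {u v : ℕ → Ω → ℝ} {α β : ℕ → ℝ} (hum : ∀ n, Measurable (u n))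
    (hvm : ∀ n, Measurable (v n)) (hub : ∀ n, ∃ C, ∀ ω, |u n ω| ≤ C)
    (hvb : ∀ n, ∃ C, ∀ ω, |v n ω| ≤ C) {K : ℝ} (hu2 : ∀ᶠ n in atTop, ∫ ω, u n ω ^ 2 ∂μ ≤ K)
    (hv2 : ∀ᶠ n in atTop, ∫ ω, v n ω ^ 2 ∂μ ≤ K)
    (hu : Tendsto (fun n => ∫ ω, u n ω ∂μ - α n) atTop (𝓝 0))
    (hv : Tendsto (fun n => ∫ ω, v n ω ∂μ - β n) atTop (𝓝 0)) {Y : ℕ → Ω → ℝ}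
    (hY : InProbZero μ Y) (x y : ℝ) (h : ∀ n ω, x * v n ω + y * u n ω ≤ |Y n ω|) {ε : ℝ}
    (hε : 0 < ε) : ∀ᶠ n in atTop, x * β n + y * α n ≤ ε := by
  -- The hypothesis bounds the combination only from above, so its positive part is what is
  -- dominated by |Y|. This suffices for an upper bound on the mean.
  set w : ℕ → Ω → ℝ := fun n ω => max (x * v n ω + y * u n ω) 0
  have hint {z : ℕ → Ω → ℝ} (hzm : ∀ n, Measurable (z n)) (hzb : ∀ n, ∃ C, ∀ ω, |z n ω| ≤ C)
      (n : ℕ) : Integrable (z n) μ := by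
    obtain ⟨C, hC⟩ := hzb n
    exact Integrable.of_bound (hzm n).aestronglyMeasurable C (Eventually.of_forall hC)
  have hint2 {z : ℕ → Ω → ℝ} (hzm : ∀ n, Measurable (z n)) (hzb : ∀ n, ∃ C, ∀ ω, |z n ω| ≤ C)
      (n : ℕ) : Integrable (fun ω => z n ω ^ 2) μ := by
    obtain ⟨C, hC⟩ := hzb n
    refine Integrable.of_bound ((hzm n).pow_const 2).aestronglyMeasurable (C ^ 2)
      (Eventually.of_forall fun ω => ?_)
    rw [norm_pow, Real.norm_eq_abs]
    exact pow_le_pow_left₀ (abs_nonneg _) (hC ω) 2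
  have hwm (n : ℕ) : Measurable (w n) :=
    (((hvm n).const_mul x).add ((hum n).const_mul y)).max measurable_const
  have hwabs (n : ℕ) (ω : Ω) : |w n ω| ≤ |x| * |v n ω| + |y| * |u n ω| := by
    rw [abs_of_nonneg (le_max_right _ _), ← abs_mul, ← abs_mul]
    exact max_le (add_le_add (le_abs_self _) (le_abs_self _)) (by positivity)
  have hwb (n : ℕ) : ∃ C, ∀ ω, |w n ω| ≤ C := by
    obtain ⟨C, hC⟩ := hub n
    obtain ⟨C', hC'⟩ := hvb n
    refine ⟨|x| * C' + |y| * C, fun ω => (hwabs n ω).trans ?_⟩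
    gcongr
    exacts [hC' ω, hC ω]
  have hw : InProbZero μ w := hY.mono (Eventually.of_forall fun n ω => by
    rw [abs_of_nonneg (le_max_right _ _)]
    exact max_le (h n ω) (abs_nonneg _))
  have hw2 : ∀ᶠ n in atTop, ∫ ω, w n ω ^ 2 ∂μ ≤ 2 * x ^ 2 * K + 2 * y ^ 2 * K := by
    filter_upwards [hu2, hv2] with n h1 h2
    calc ∫ ω, w n ω ^ 2 ∂μ ≤ ∫ ω, (2 * x ^ 2 * v n ω ^ 2 + 2 * y ^ 2 * u n ω ^ 2) ∂μ := by
          refine integral_mono (hint2 hwm hwb n)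
            (((hint2 hvm hvb n).const_mul _).add ((hint2 hum hub n).const_mul _)) fun ω => ?_
          have h3 := pow_le_pow_left₀ (abs_nonneg _) (hwabs n ω) 2
          rw [sq_abs] at h3
          refine h3.trans ?_
          have h4 := sq_nonneg (|x| * |v n ω| - |y| * |u n ω|)
          have e1 : (|x| * |v n ω|) ^ 2 = x ^ 2 * v n ω ^ 2 := by rw [mul_pow, sq_abs, sq_abs]
          have e2 : (|y| * |u n ω|) ^ 2 = y ^ 2 * u n ω ^ 2 := by rw [mul_pow, sq_abs, sq_abs]
          nlinarith
      _ = 2 * x ^ 2 * ∫ ω, v n ω ^ 2 ∂μ + 2 * y ^ 2 * ∫ ω, u n ω ^ 2 ∂μ := by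
          rw [integral_add ((hint2 hvm hvb n).const_mul _) ((hint2 hum hub n).const_mul _),
            integral_const_mul, integral_const_mul]
      _ ≤ _ := by gcongr
  have hlim := hw.tendsto_integral_abs hwm hwb hw2
  have hlim2 := (hlim.sub (hv.const_mul x)).sub (hu.const_mul y)
  simp only [mul_zero, sub_zero] at hlim2
  filter_upwards [hlim2.eventually (gt_mem_nhds hε)] with n hn
  have h1 : x * ∫ ω, v n ω ∂μ + y * ∫ ω, u n ω ∂μ ≤ ∫ ω, |w n ω| ∂μ := by
    rw [← integral_const_mul, ← integral_const_mul,
      ← integral_add ((hint hvm hvb n).const_mul x) ((hint hum hub n).const_mul y)]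
    exact integral_mono (((hint hvm hvb n).const_mul x).add ((hint hum hub n).const_mul y))
      (hint hwm hwb n).abs fun ω => (le_max_left _ _).trans (le_abs_self _)
  linarith

end Comparison

/-! ### Regular variation of the renewal function. -/

theorem IsSlowlyVarying.const_mul {L : ℝ → ℝ} (hL : IsSlowlyVarying L) {c : ℝ} (hc : 0 < c) :
    IsSlowlyVarying (fun x => c * L x) where
  measurable := hL.measurable.const_mul c
  eventually_pos := hL.eventually_pos.mono fun _ hx => mul_pos hc hx
  tendsto r hr := (hL.tendsto r hr).congr fun _ => (mul_div_mul_left _ _ hc.ne').symm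

theorem lintegral_chainLaw_sum {E : Type*} [MeasurableSpace E] {P : Kernel E E} [IsMarkovKernel P]
    (lam : Measure E) [IsProbabilityMeasure lam] {f : E → ℝ≥0∞}
    (hf : Measurable f) (n : ℕ) :
    ∫⁻ ω, ∑ t ∈ Finset.range n, f (ω t) ∂(chainLaw P lam) =
      ∫⁻ x, occupation P f n x ∂lam := by
  rw [(isMarkovChain_chainLaw P lam).lintegral_sum_eq n hf, map_chainLaw_zero]

namespace Atom

variable {E : Type*} [MeasurableSpace E] {φ : Measure E} {P : Kernel E E} [IsMarkovKernel P]
  (a : Atom φ P)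

/-- In a `β`-null recurrent chain the renewal function of every atom is regularly varying. -/
theorem exists_slowlyVarying (hP : IsHarrisRecurrent φ P) {β : ℝ}
    (hβ : IsBetaNullRecurrent φ P β) :
    ∃ L : ℝ → ℝ, IsSlowlyVarying L ∧
      Asymptotics.IsEquivalent atTop (fun n : ℕ => (a.renewal (n + 1)).toReal)
        (fun n : ℕ => 1 / Real.Gamma (1 + β) * (n : ℝ) ^ β * L n) := by
  obtain ⟨-, -, f, lam, L, hf, hlam, hL, heq⟩ := hβ
  obtain ⟨K, hK, hG⟩ := a.exists_green_le_of_isSmallFun hP hf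
  have hocc := a.isEquivalent_occupation hP hf.1 hK hG lam
  have hc : 0 < (∫⁻ y, f y ∂a.invMeasure).toReal :=
    ENNReal.toReal_pos (a.invMeasure_pos hP hf.1).ne'
      (ne_top_of_le_ne_top hK (a.lintegral_invMeasure_le hf.1.1 hG))
  set c := (∫⁻ y, f y ∂a.invMeasure).toReal
  refine ⟨fun x => c⁻¹ * L x, hL.const_mul (inv_pos.2 hc), ?_⟩
  simp_rw [lintegral_chainLaw_sum lam hf.1.1] at heq
  -- The defining sum runs over t ≤ n, which is an occupation sum of length n + 1.
  have h1 := (hocc.comp_tendsto (tendsto_add_atTop_nat 1)).symm.trans heq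
  have h2 := (Asymptotics.IsEquivalent.refl (u := fun _ : ℕ => c⁻¹) (l := atTop)).mul h1
  refine (h2.congr_left (Eventually.of_forall fun n => ?_)).congr_right
    (Eventually.of_forall fun n => ?_)
  · simp only [Pi.mul_apply, Function.comp]
    rw [inv_mul_cancel_left₀ hc.ne']
  · simp only [Pi.mul_apply]
    ring

end Atom

/-! ### Normalized sums, and comparison of a chain with a Markovian image. -/

namespace Atom

theorem sum_centred {E Ω : Type*} [MeasurableSpace E] {φ : Measure E} {P : Kernel E E}
    (a : Atom φ P) {Z : ℕ → Ω → E} (f : E → ℝ≥0∞) (c : ℝ) (n : ℕ) (ω : Ω) :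
    ∑ t ∈ Finset.range n, a.centred f c (Z t ω) =
      ∑ t ∈ Finset.range n, (f (Z t ω)).toReal -
        c * ∑ t ∈ Finset.range n, (a.s (Z t ω)).toReal := by
  unfold centred
  rw [Finset.sum_sub_distrib, Finset.mul_sum]

/-- The normalized sum of `s` along the path. -/
noncomputable def normSum {E Ω : Type*} [MeasurableSpace E] {φ : Measure E} {P : Kernel E E}
    (a : Atom φ P) (Z : ℕ → Ω → E) (b : ℕ → ℝ) (n : ℕ) (ω : Ω) : ℝ :=
  (∑ t ∈ Finset.range n, (a.s (Z t ω)).toReal) / b n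

section Normalized

variable {E : Type*} [MeasurableSpace E] {φ : Measure E} {P : Kernel E E} [IsMarkovKernel P]
  (a : Atom φ P) {Ω : Type*} [MeasurableSpace Ω] {Z : ℕ → Ω → E} {μ : Measure Ω}
  [IsProbabilityMeasure μ] {b : ℕ → ℝ}

theorem measurable_normSum (hZ : ∀ t, Measurable (Z t)) (n : ℕ) : Measurable (a.normSum Z b n) :=
  (measurable_sum_comp hZ a.measurable_toReal_s n).div_const _

theorem exists_abs_normSum_le (n : ℕ) : ∃ C, ∀ ω, |a.normSum Z b n ω| ≤ C := by
  refine ⟨n * 1 / |b n|, fun ω => ?_⟩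
  rw [normSum, abs_div]
  gcongr
  exact abs_sum_comp_le a.abs_toReal_s_le n ω

theorem tendsto_integral_normSum_sub (hP : IsHarrisRecurrent φ P) (hZ : IsMarkovChain P Z μ)
    (hb : ∀ n, (a.renewal n).toReal ≤ b n) :
    Tendsto (fun n => ∫ ω, a.normSum Z b n ω ∂μ - (a.renewal n).toReal / b n) atTop (𝓝 0) := by
  have : IsProbabilityMeasure (μ.map (Z 0)) :=
    Measure.isProbabilityMeasure_map (hZ.measurable 0).aemeasurable
  have hO : (fun n => (a.renewal n).toReal) =O[atTop] b :=
    Asymptotics.IsBigO.of_bound 1 (Eventually.of_forall fun n => by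
      have h0 : 0 ≤ (a.renewal n).toReal := ENNReal.toReal_nonneg
      rw [Real.norm_eq_abs, Real.norm_eq_abs, abs_of_nonneg h0, abs_of_nonneg (h0.trans (hb n)),
        one_mul]
      exact hb n)
  have h := ((a.isEquivalent_renewal hP (μ.map (Z 0))).isLittleO.trans_isBigO hO)
  refine h.tendsto_div_nhds_zero.congr fun n => ?_
  unfold normSum
  rw [integral_div, hZ.integral_sum_toReal a.measurable_s a.s_le_one, Pi.sub_apply, sub_div]

theorem eventually_integral_normSum_sq_le (hZ : IsMarkovChain P Z μ)
    (hb : ∀ n, (a.renewal n).toReal ≤ b n) (hlim : Tendsto b atTop atTop) :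
    ∀ᶠ n in atTop, ∫ ω, a.normSum Z b n ω ^ 2 ∂μ ≤ 8 := by
  -- Once b ≥ 1, the bound 2(1 + A)² is at most 2(2b)² = 8b².
  filter_upwards [hlim.eventually_ge_atTop 1] with n hn
  unfold normSum
  simp_rw [div_pow]
  rw [integral_div, div_le_iff₀ (by positivity)]
  refine (a.integral_sum_s_sq_le hZ n).trans ?_
  have h0 : 0 ≤ (a.renewal n).toReal := ENNReal.toReal_nonneg
  nlinarith [hb n]

end Normalized

variable {E E' : Type*} [MeasurableSpace E] [MeasurableSpace E'] {φ : Measure E}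
  {P : Kernel E E} [IsMarkovKernel P] {φ' : Measure E'} {P' : Kernel E' E'} [IsMarkovKernel P']
  {Ω : Type*} [MeasurableSpace Ω] {Z : ℕ → Ω → E} {μ : Measure Ω} [IsProbabilityMeasure μ]

/-- Comparison of the invariant measures and of the renewal functions of a Harris recurrent chain
and of a Harris recurrent Markovian image of it. -/
theorem factor_comparison (a : Atom φ P) (hP : IsHarrisRecurrent φ P) (hZ : IsMarkovChain P Z μ)
    (a' : Atom φ' P') (hP' : IsHarrisRecurrent φ' P') {p : E → E'} (hp : Measurable p)
    (hX : IsMarkovChain P' (fun t ω => p (Z t ω)) μ) {C : Set E'} (hC : MeasurableSet C)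
    (hCpos : 0 < φ' C) (hfin : a.invMeasure (p ⁻¹' C) ≠ ∞) :
    (∫⁻ x, a'.s (p x) ∂a.invMeasure) ≠ 0 ∧ (∫⁻ x, a'.s (p x) ∂a.invMeasure) ≠ ∞ ∧
      a'.invMeasure C = a.invMeasure (p ⁻¹' C) / ∫⁻ x, a'.s (p x) ∂a.invMeasure ∧
      Asymptotics.IsEquivalent atTop (fun n => (a'.renewal n).toReal)
        (fun n => (∫⁻ x, a'.s (p x) ∂a.invMeasure).toReal * (a.renewal n).toReal) := by
  set A : ℕ → ℝ := fun n => (a.renewal n).toReal with hAdef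
  set B : ℕ → ℝ := fun n => (a'.renewal n).toReal with hBdef
  -- Neither renewal function is known yet to dominate the other. Dividing by their sum keeps both
  -- normalized sums bounded in L².
  set N : ℕ → ℝ := fun n => A n + B n with hNdef
  have hA0 (n : ℕ) : 0 ≤ A n := ENNReal.toReal_nonneg
  have hB0 (n : ℕ) : 0 ≤ B n := ENNReal.toReal_nonneg
  have hN0 (n : ℕ) : 0 ≤ N n := add_nonneg (hA0 n) (hB0 n)
  have hAN (n : ℕ) : A n ≤ N n := le_add_of_nonneg_right (hB0 n)
  have hBN (n : ℕ) : B n ≤ N n := le_add_of_nonneg_left (hA0 n)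
  have hAlim : Tendsto A atTop atTop := a.tendsto_renewal hP
  have hBlim : Tendsto B atTop atTop := a'.tendsto_renewal hP'
  have hNlim : Tendsto N atTop atTop := tendsto_atTop_mono hAN hAlim
  set X : ℕ → Ω → E' := fun t ω => p (Z t ω) with hXdef
  -- the comparison principle for the two normalized sums
  have key {Y : ℕ → Ω → ℝ} (hY : InProbZero μ Y) (x y : ℝ)
      (h : ∀ n ω, x * a'.normSum X N n ω + y * a.normSum Z N n ω ≤ |Y n ω|) {ε : ℝ} (hε : 0 < ε) :
      ∀ᶠ n in atTop, x * (B n / N n) + y * (A n / N n) ≤ ε :=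
    eventually_mean_le (a.measurable_normSum hZ.measurable) (a'.measurable_normSum hX.measurable)
      a.exists_abs_normSum_le a'.exists_abs_normSum_le
      (a.eventually_integral_normSum_sq_le hZ hAN hNlim)
      (a'.eventually_integral_normSum_sq_le hX hBN hNlim)
      (a.tendsto_integral_normSum_sub hP hZ hAN)
      (a'.tendsto_integral_normSum_sub hP' hX hBN) hY x y h hε
  -- the function `1_C`, on both spaces
  set d' : E' → ℝ≥0∞ := C.indicator 1 with hd'
  have hd'm : Measurable d' := measurable_one.indicator hC
  have hd'1 (x : E') : d' x ≤ 1 := Set.indicator_le_self _ _ x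
  have hd'pos : IsPosFun φ' d' := by
    refine ⟨hd'm, hCpos.trans_le (measure_mono fun x hx => ?_)⟩
    simp [hd', hx]
  have hd'π : ∫⁻ x, d' x ∂a'.invMeasure = a'.invMeasure C := lintegral_indicator_one hC
  have hdm : Measurable fun x => d' (p x) := hd'm.comp hp
  have hdπ : ∫⁻ x, d' (p x) ∂a.invMeasure = a.invMeasure (p ⁻¹' C) := by
    rw [← lintegral_indicator_one (hp hC)]; rfl
  have hdfin : ∫⁻ x, d' (p x) ∂a.invMeasure ≠ ∞ := by rwa [hdπ]
  have hD := a.inProbZero_centred hP hZ hdm (fun x => hd'1 (p x)) hdfin hAN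
  rw [hdπ] at hD
  set c := (a.invMeasure (p ⁻¹' C)).toReal
  have hc0 : 0 ≤ c := ENNReal.toReal_nonneg
  have hvm : Measurable fun x => a'.s (p x) := a'.measurable_s.comp hp
  have hv1 (x : E) : a'.s (p x) ≤ 1 := a'.s_le_one _
  have hNpos := hNlim.eventually_gt_atTop 0
  have hαβ : ∀ᶠ n in atTop, A n / N n + B n / N n = 1 := by
    filter_upwards [hNpos] with n hn
    rw [← add_div, div_self hn.ne']
  have hα0 (n : ℕ) : 0 ≤ A n / N n := div_nonneg (hA0 n) (hN0 n)
  have hβ0 (n : ℕ) : 0 ≤ B n / N n := div_nonneg (hB0 n) (hN0 n)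
  -- lower truncations of `1_C` for the image chain
  set r : ℕ → ℝ := fun k => (∫⁻ y, a'.trunc d' k y ∂a'.invMeasure).toReal with hr
  -- The image measure of C is not known to be finite, so the ratio theorem is applied to a
  -- truncation below 1_C. This yields only the inequality r_k B ≤ c A up to a small multiple of N.
  have hrle (k : ℕ) {ε : ℝ} (hε : 0 < ε) :
      ∀ᶠ n in atTop, r k * (B n / N n) + -c * (A n / N n) ≤ ε := by
    have hg := a'.measurable_trunc hd'm k
    have hg1 (x : E') : a'.trunc d' k x ≤ 1 := (a'.trunc_le d' k x).trans (hd'1 x)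
    have hT := a'.inProbZero_centred hP' hX hg hg1
      (a'.lintegral_invMeasure_trunc_ne_top hd'm hd'1 k) hBN
    have hTm (n : ℕ) : Measurable fun ω => (∑ t ∈ Finset.range n,
        a'.centred (a'.trunc d' k) (r k) (X t ω)) / N n :=
      (measurable_sum_comp hX.measurable (a'.measurable_centred hg _) n).div_const _
    have hY := (hT.const_mul hTm (-1)).add hD fun n => (hTm n).const_mul (-1)
    refine key hY (r k) (-c) (fun n ω => le_trans ?_ (le_abs_self _)) hε
    rw [a'.sum_centred, a.sum_centred, normSum, normSum]
    have hle : ∑ t ∈ Finset.range n, (a'.trunc d' k (X t ω)).toReal ≤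
        ∑ t ∈ Finset.range n, (d' (p (Z t ω))).toReal :=
      Finset.sum_le_sum fun t _ => ENNReal.toReal_mono
        ((hd'1 _).trans_lt ENNReal.one_lt_top).ne (a'.trunc_le d' k _)
    have := div_le_div_of_nonneg_right hle (hN0 n)
    simp only [sub_div, mul_div_assoc]
    change _ ≤ -1 * (_ - r k * _) + _
    linarith
  have hrlim := a'.tendsto_lintegral_trunc hP' hd'm a'.invMeasure
  rw [hd'π] at hrlim
  have hrfin (k : ℕ) := a'.lintegral_invMeasure_trunc_ne_top hd'm hd'1 k
  -- the renewal function of the chain is not negligible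
  obtain ⟨α₀, hα₀, hα⟩ : ∃ α₀ : ℝ, 0 < α₀ ∧ ∀ᶠ n in atTop, α₀ ≤ A n / N n := by
    have hpos : 0 < a'.invMeasure C := by rw [← hd'π]; exact a'.invMeasure_pos hP' hd'pos
    obtain ⟨k, hk⟩ := (hrlim.eventually (lt_mem_nhds hpos)).exists
    have hrk : 0 < r k := ENNReal.toReal_pos hk.ne' (hrfin k)
    -- Substituting B/N = 1 - A/N into `hrle` with error r_k/2 and solving for A/N gives this
    -- constant.
    refine ⟨r k / 2 / (r k + c), by positivity, ?_⟩
    filter_upwards [hrle k (half_pos hrk), hαβ] with n h1 h2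
    rw [div_le_iff₀ (by positivity)]
    have : B n / N n = 1 - A n / N n := by linarith
    rw [this] at h1
    linarith
  -- `q` is finite
  set q := ∫⁻ x, a'.s (p x) ∂a.invMeasure with hq
  have hqfin : q ≠ ∞ := by
    have hlim := a.tendsto_lintegral_trunc hP hvm a.invMeasure
    -- The comparison with error 1 gives q_k A/N ≤ 1 + B/N ≤ 2, and A/N ≥ α₀.
    have hle (k : ℕ) : ∫⁻ y, a.trunc (fun x => a'.s (p x)) k y ∂a.invMeasure ≤
        ENNReal.ofReal (2 / α₀) := by
      have hfin' := a.lintegral_invMeasure_trunc_ne_top hvm hv1 k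
      rw [← ENNReal.ofReal_toReal hfin']
      refine ENNReal.ofReal_le_ofReal ?_
      have hT := a.inProbZero_centred hP hZ (a.measurable_trunc hvm k)
        (fun x => (a.trunc_le _ k x).trans (hv1 x)) hfin' hAN
      set qk := (∫⁻ y, a.trunc (fun x => a'.s (p x)) k y ∂a.invMeasure).toReal
      have hqk : 0 ≤ qk := ENNReal.toReal_nonneg
      have hev := key hT (-1) qk (fun n ω => by
        rw [abs_div, abs_of_nonneg (hN0 n)]
        refine le_trans ?_ (div_le_div_of_nonneg_right (neg_le_abs _) (hN0 n))
        rw [a.sum_centred, normSum, normSum]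
        have hle : ∑ t ∈ Finset.range n, (a.trunc (fun x => a'.s (p x)) k (Z t ω)).toReal ≤
            ∑ t ∈ Finset.range n, (a'.s (X t ω)).toReal :=
          Finset.sum_le_sum fun t _ => ENNReal.toReal_mono
            ((hv1 _).trans_lt ENNReal.one_lt_top).ne (a.trunc_le _ k _)
        have := div_le_div_of_nonneg_right hle (hN0 n)
        simp only [neg_sub, sub_div, mul_div_assoc]
        linarith) one_pos
      obtain ⟨n, h1, h2, h3⟩ := (hev.and (hα.and hαβ)).exists
      rw [le_div_iff₀ hα₀]
      have := mul_le_mul_of_nonneg_left h2 hqk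
      have := hα0 n
      linarith
    exact ne_top_of_le_ne_top ENNReal.ofReal_ne_top (le_of_tendsto' hlim hle)
  have hV := a.inProbZero_centred hP hZ hvm hv1 hqfin hAN
  -- the two renewal functions are asymptotically proportional
  have hq_abs {ε : ℝ} (hε : 0 < ε) :
      ∀ᶠ n in atTop, |B n / N n - q.toReal * (A n / N n)| ≤ ε := by
    have heq (n : ℕ) (ω : Ω) : (∑ t ∈ Finset.range n,
        a.centred (fun x => a'.s (p x)) q.toReal (Z t ω)) / N n =
        a'.normSum X N n ω - q.toReal * a.normSum Z N n ω := by
      rw [a.sum_centred, normSum, normSum, sub_div, mul_div_assoc]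
    have e1 := key hV 1 (-q.toReal) (fun n ω => by
      refine le_trans (le_of_eq ?_) (le_abs_self _)
      rw [heq]; ring) hε
    have e2 := key hV (-1) q.toReal (fun n ω => by
      refine le_trans (le_of_eq ?_) (neg_le_abs _)
      rw [heq]; ring) hε
    filter_upwards [e1, e2] with n h1 h2
    rw [abs_le]; constructor <;> linarith
  -- `q` is positive
  have hq0 : q ≠ 0 := by
    intro h0
    -- Normalizing by N would only show B/N → 0, which is no contradiction. Normalizing by B forces
    -- the mean of the normalized sum, asymptotically B/B = 1, to vanish.
    have hY := a.inProbZero_of_invMeasure_eq_zero hP hZ hvm hv1 h0 hBlim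
    have hev := eventually_mean_le (u := fun _ _ => 0) (α := fun _ => 0) (x := 1) (y := 0)
      (ε := 1 / 2) (fun _ => measurable_const) (a'.measurable_normSum hX.measurable (b := B))
      (fun _ => ⟨0, by simp⟩) a'.exists_abs_normSum_le (K := 8)
      (Eventually.of_forall fun _ => by simp)
      (a'.eventually_integral_normSum_sq_le hX (fun _ => le_rfl) hBlim) (by simp)
      (a'.tendsto_integral_normSum_sub hP' hX fun _ => le_rfl) hY
      (fun n ω => by
        rw [one_mul, zero_mul, add_zero]
        exact le_abs_self _) (by norm_num)
    obtain ⟨n, h1, h2⟩ := (hev.and (hBlim.eventually_gt_atTop 0)).exists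
    have : B n / B n = 1 := div_self h2.ne'
    simp only [hBdef] at this
    rw [one_mul, mul_zero, add_zero, this] at h1
    norm_num at h1
  have hqr : 0 < q.toReal := ENNReal.toReal_pos hq0 hqfin
  -- `a'.invMeasure C` is finite
  have hrk (k : ℕ) : r k ≤ c / q.toReal := by
    rw [le_div_iff₀ hqr]
    refine le_of_forall_pos_le_add fun ε hε => ?_
    have hrk0 : 0 ≤ r k := ENNReal.toReal_nonneg
    set η := ε * α₀ / (1 + r k)
    -- The tolerance η absorbs one error from `hrle` and r_k times one from `hq_abs`; the total (1 +
    -- r_k)η = εα₀ is at most ε A/N, so A/N can be cancelled.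
    have hη : 0 < η := by positivity
    obtain ⟨n, h1, h2, h3⟩ := ((hrle k hη).and ((hq_abs hη).and hα)).exists
    have h4 := (abs_le.1 h2).1
    have h5 := mul_le_mul_of_nonneg_left h4 hrk0
    have h6 : (1 + r k) * η = ε * α₀ := by simp only [η]; field_simp
    have h7 : (r k * q.toReal - c) * (A n / N n) ≤ ε * α₀ := by nlinarith
    have h8 : (r k * q.toReal - c) * (A n / N n) ≤ ε * (A n / N n) :=
      h7.trans (mul_le_mul_of_nonneg_left h3 hε.le)
    have := le_of_mul_le_mul_right h8 (hα₀.trans_le h3)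
    linarith
  have hRfin : a'.invMeasure C ≠ ∞ := by
    refine ne_top_of_le_ne_top ENNReal.ofReal_ne_top
      (le_of_tendsto' hrlim fun k => (?_ : _ ≤ ENNReal.ofReal (c / q.toReal)))
    rw [← ENNReal.ofReal_toReal (hrfin k)]
    exact ENNReal.ofReal_le_ofReal (hrk k)
  -- identification of `a'.invMeasure C`
  have hD' := a'.inProbZero_centred hP' hX hd'm hd'1 (by rwa [hd'π]) hBN
  rw [hd'π] at hD'
  set R := (a'.invMeasure C).toReal with hR
  -- The sum of 1_C along the path is evaluated by both chains. Subtracting eliminates it and leaves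
  -- R S' - c S negligible, which with B ≈ q A gives the identity.
  have hRq : R * q.toReal = c := by
    have hD'm (n : ℕ) : Measurable fun ω => (∑ t ∈ Finset.range n,
        a'.centred d' R (X t ω)) / N n :=
      (measurable_sum_comp hX.measurable (a'.measurable_centred hd'm _) n).div_const _
    have hY := (hD'.const_mul hD'm (-1)).add hD fun n => (hD'm n).const_mul (-1)
    have heq (n : ℕ) (ω : Ω) : -1 * ((∑ t ∈ Finset.range n, a'.centred d' R (X t ω)) / N n) +
        (∑ t ∈ Finset.range n, a.centred (fun x => d' (p x)) c (Z t ω)) / N n =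
        R * a'.normSum X N n ω - c * a.normSum Z N n ω := by
      rw [a.sum_centred, a'.sum_centred, normSum, normSum]
      simp only [sub_div, mul_div_assoc, hXdef]
      ring
    have hR0 : 0 ≤ R := ENNReal.toReal_nonneg
    refine eq_of_forall_dist_le fun ε hε => ?_
    rw [Real.dist_eq]
    set η := ε * α₀ / (1 + R)
    have hη : 0 < η := by positivity
    have e1 := key hY R (-c) (fun n ω => by
      refine le_trans (le_of_eq ?_) (le_abs_self _)
      rw [heq]; ring) hη
    have e2 := key hY (-R) c (fun n ω => by
      refine le_trans (le_of_eq ?_) (neg_le_abs _)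
      rw [heq]; ring) hη
    obtain ⟨n, h1, h2, h3, h4⟩ := (e1.and (e2.and ((hq_abs hη).and hα))).exists
    have h5 := abs_le.1 h3
    have h6 : (1 + R) * η = ε * α₀ := by simp only [η]; field_simp
    have h7 := mul_le_mul_of_nonneg_left h5.1 hR0
    have h8 := mul_le_mul_of_nonneg_left h5.2 hR0
    have h9 : |(R * q.toReal - c) * (A n / N n)| ≤ ε * α₀ := by
      rw [abs_le]; constructor <;> nlinarith
    rw [abs_mul, abs_of_nonneg (hα0 n)] at h9
    exact le_of_mul_le_mul_right (h9.trans (mul_le_mul_of_nonneg_left h4 hε.le))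
      (hα₀.trans_le h4)
  refine ⟨hq0, hqfin, ?_, ?_⟩
  · rw [ENNReal.eq_div_iff hq0 hqfin, ← ENNReal.toReal_eq_toReal_iff' (by finiteness) hfin,
      ENNReal.toReal_mul, mul_comm]
    exact hRq
  · rw [Asymptotics.IsEquivalent, Asymptotics.isLittleO_iff]
    intro ε hε
    -- An error εqα₀N in B is at most ε q A, because A ≥ α₀N.
    filter_upwards [hq_abs (show 0 < ε * (q.toReal * α₀) by positivity), hα, hNpos]
      with n h1 h2 h3
    rw [Pi.sub_apply, Real.norm_eq_abs, Real.norm_eq_abs, abs_of_nonneg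
      (mul_nonneg hqr.le (hA0 n))]
    have h4 : |B n / N n - q.toReal * (A n / N n)| = |B n - q.toReal * A n| / N n := by
      rw [← mul_div_assoc, ← sub_div, abs_div, abs_of_pos h3]
    rw [h4, div_le_iff₀ h3] at h1
    rw [le_div_iff₀ h3] at h2
    calc _ ≤ _ := h1
      _ = ε * (q.toReal * (α₀ * N n)) := by ring
      _ ≤ _ := by gcongr

end Atom

theorem lemma4p1 {E₁ E₂ Ω : Type*} [MeasurableSpace E₁] [MeasurableSpace E₂] [MeasurableSpace Ω]
    -- the compound process and its transition probability
    (μ : Measure Ω) [IsProbabilityMeasure μ] (X : ℕ → Ω → E₁) (W : ℕ → Ω → E₂)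
    (P : Kernel (E₁ × E₂) (E₁ × E₂)) [IsMarkovKernel P]
    (hXW : IsMarkovChain P (fun t ω => (X t ω, W t ω)) μ)
    -- the compound chain is Harris recurrent and has an atom
    (φ : Measure (E₁ × E₂)) (hP : IsHarrisRecurrent φ P) (a : Atom φ P)
    -- the first component is a Harris recurrent Markov chain, has an atom, is β-null recurrent
    (P₁ : Kernel E₁ E₁) [IsMarkovKernel P₁] (hX : IsMarkovChain P₁ X μ)
    (φ₁ : Measure E₁) (hP₁ : IsHarrisRecurrent φ₁ P₁) (a₁ : Atom φ₁ P₁)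
    (β : ℝ) (hβ : IsBetaNullRecurrent φ₁ P₁ β)
    -- the set C₁
    (C₁ : Set E₁) (hC₁ : MeasurableSet C₁) (hC₁pos : 0 < φ₁ C₁)
    (hC₁E₂pos : 0 < φ (C₁ ×ˢ Set.univ)) (hint : a.invMeasure (C₁ ×ˢ Set.univ) < ∞) :
    IsBetaNullRecurrent φ P β ∧
      0 < ∫⁻ x, a₁.s x ∂(a.invMeasure.map Prod.fst) ∧
      ∫⁻ x, a₁.s x ∂(a.invMeasure.map Prod.fst) < ∞ ∧
      a₁.invMeasure C₁ =
        a.invMeasure (C₁ ×ˢ Set.univ) / ∫⁻ x, a₁.s x ∂(a.invMeasure.map Prod.fst) := by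
  rw [lintegral_map a₁.measurable_s measurable_fst]
  rw [Set.prod_univ] at hint ⊢
  obtain ⟨hq0, hqfin, hratio, hequiv⟩ := a.factor_comparison hP hXW a₁ hP₁ measurable_fst hX
    hC₁ hC₁pos hint.ne
  refine ⟨?_, pos_iff_ne_zero.2 hq0, lt_top_iff_ne_top.2 hqfin, hratio⟩
  obtain ⟨L, hL, hren⟩ := a₁.exists_slowlyVarying hP₁ hβ
  have hq := ENNReal.toReal_pos hq0 hqfin
  set q := (∫⁻ x, a₁.s x.1 ∂a.invMeasure).toReal
  have := a.isProb
  -- The atom itself is the witness: under ν the expected sum of s is the renewal function,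
  -- asymptotically q⁻¹ times that of X, so the slowly varying function is divided by q.
  refine ⟨hβ.1, hβ.2.1, a.s, a.ν, fun x => q⁻¹ * L x, a.isSmallFun, a.isProb,
    hL.const_mul (inv_pos.2 hq), ?_⟩
  simp_rw [lintegral_chainLaw_sum a.ν a.measurable_s]
  have h1 := (hequiv.comp_tendsto (tendsto_add_atTop_nat 1)).symm.trans hren
  have h2 := (Asymptotics.IsEquivalent.refl (u := fun _ : ℕ => q⁻¹) (l := atTop)).mul h1
  refine (h2.congr_left (Eventually.of_forall fun n => ?_)).congr_right
    (Eventually.of_forall fun n => ?_)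
  · simp only [Pi.mul_apply, Function.comp]
    rw [inv_mul_cancel_left₀ hq.ne']
    rfl
  · simp only [Pi.mul_apply]
    ring
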